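/- Let $A$ be a finite alphabet. Let $\mathcal M(A^{\mathbb Z})$ be the set of shift-invariant Borel probability measures on $A^{\mathbb Z}$ with the distance $$d_{\mathcal M}(\mu,\nu)=\sum_{n\ge 0}2^{-n}\cdot\tfrac12\sum_{u\in A^{\{-n,\dots,n\}}}|\mu([u])-\nu([u])|,$$ where $[u]=\{x : x_i=u_i \text{ for } -n\le i\le n\}$. This distance induces the weak topology. Let $F$ be a cellular automaton on $A^{\mathbb Z}$ with finite neighbourhood $N\subset\mathbb Z$ and local rule $f:A^N\to A$. A perturbation $(F_\epsilon)_{\epsilon>0}$ of $F$ is given by stochastic matrices $f_\epsilon:A^N\times A\to[0,1]$ (so $\sum_{b\in A} f_\epsilon(u,b)=1$ for all $u\in A^N$) such that $f_\epsilon(u,f(u))\ge 1-\epsilon$ for all $\epsilon>0$ and $u\in A^N$. Here $F_\epsilon$ is the probabilistic cellular automaton which, given $x\in A^{\mathbb Z}$, draws the new symbols at all sites $i\in\mathbb Z$ independently with laws $f_\epsilon((x_{i+j})_{j\in N},\cdot)$. Put $f_0(u,a)=1$ if $a=f(u)$ and $f_0(u,a)=0$ otherwise. The perturbation is *computable* if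 $\epsilon\mapsto f_\epsilon$ is a computable map from $[0,1]$ to $[0,1]^{A^N\times A}$: for all $u\in A^N$ and $a\in A$ there are computable functions $\alpha:\mathbb N\to\mathbb N$ and $\beta:(\mathbb Q\cap[0,1])\times\mathbb N\to\mathbb Q\cap[0,1]$ such that, for all $n$, $|f_s(u,a)-f_t(u,a)|\le 2^{-n}$ whenever $s,t\in[0,1]$ and $|s-t|\le 2^{-\alpha(n)}$, and $|f_q(u,a)-\beta(q,n)|\le 2^{-n}$ for all $q\in\mathbb Q\cap[0,1]$. Let $\mathcal M_\epsilon\subset\mathcal M(A^{\mathbb Z})$ be the set of shift-invariant probability measures that are invariant under $F_\epsilon$. The set $\mathcal M_{\lim}$ of zero-noise limits consists of the $\mu\in\mathcal M(A^{\mathbb Z})$ such that for all $\delta,\epsilon_0>0$ there are $\epsilon\in(0,\epsilon_0)$ and $\nu\in\mathcal M_\epsilon$ with $d_{\mathcal M}(\mu,\nu)<\delta$. The set $\mathcal M_s$ of stable measures consists of the $\nu\in\mathcal M(A^{\mathbb Z})$ for which there is a family $(\pi_\epsilon)_{\epsilon>0}$ with $\pi_\epsilon\in\mathcal M_\epsilon$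 for all $\epsilon>0$ and $\pi_\epsilon\to\nu$ as $\epsilon\to0$. For a nonempty finite word $w$ over $A$ let $\widehat{\delta_w}\in\mathcal M(A^{\mathbb Z})$ be the uniform measure on the shift orbit of the periodic configuration $\cdots www\cdots$. A closed set $K\subset\mathcal M(A^{\mathbb Z})$ is *$\Pi_3$-computable* if there is a computable Boolean function $g$ such that, for all nonempty words $w$ and all $r\in\mathbb Q$, $$K\cap\{\mu: d_{\mathcal M}(\widehat{\delta_w},\mu)\le r\}\neq\emptyset\iff\forall y_1\in\mathbb N\ \exists y_2\in\mathbb N\ \forall y_3\in\mathbb N,\ g(w,r,y_1,y_2,y_3)=1.$$ **Proposition.** If $(F_\epsilon)_{\epsilon>0}$ is a computable perturbation of a cellular automaton $F$, then $\mathcal M_{\lim}$ and $\mathcal M_s$ are both $\Pi_3$-computable closed subsets of $\mathcal M(A^{\mathbb Z})$. -/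

import Mathlib

open MeasureTheory Set Filter Topology

namespace NoisyCA

/-! ### Computability on metric spaces with a numbered dense set -/

/-- The rational number `p / (q + 1)` with code `(p, q)`. Every rational number has a code. -/
def ratOfCode (c : ℤ × ℕ) : ℚ := (c.1 : ℚ) / ((c.2 : ℚ) + 1)

/-- The rational number `min p (q + 1) / (q + 1)` of `[0, 1]` with code `(p, q)`. Every rational
number in `[0, 1]` has a code. -/
noncomputable def unitRatOfCode (c : ℕ × ℕ) : unitInterval :=
  ⟨((min c.1 (c.2 + 1) : ℕ) : ℝ) / ((c.2 : ℝ) + 1), by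
    have h : (0 : ℝ) < (c.2 : ℝ) + 1 := by positivity
    refine ⟨by positivity, (div_le_one h).2 ?_⟩
    exact_mod_cast min_le_right c.1 (c.2 + 1)⟩

/-- A map `F : X → Y` is computable, relative to the numbered families of ideal points `p` of `X`
and `q` of `Y`, if it has a computable modulus of uniform continuity and its values at the ideal
points of `X` can be computed uniformly at any precision. -/
def IsComputableMap {ι κ X Y : Type*} [Primcodable ι] [Primcodable κ]
    [PseudoMetricSpace X] [PseudoMetricSpace Y] (p : ι → X) (q : κ → Y) (F : X → Y) : Prop :=
  (∃ a : ℕ → ℕ, Computable a ∧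
    ∀ (n : ℕ) (x y : X), dist x y ≤ (1 / 2 : ℝ) ^ a n → dist (F x) (F y) ≤ (1 / 2 : ℝ) ^ n) ∧
  ∃ b : ι × ℕ → κ, Computable b ∧
    ∀ (i : ι) (n : ℕ), dist (F (p i)) (q (b (i, n))) ≤ (1 / 2 : ℝ) ^ n

/-- A subset `K` of `X` is a `Π₃`-computable closed set, relative to the numbered family of ideal
points `p`, if it is closed and if the closed ideal balls that meet it are described by a formula
`∀ ∃ ∀` over a computable Boolean function. -/
def IsPiThreeComputableClosed {ι X : Type*} [Primcodable ι] [PseudoMetricSpace X]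
    (p : ι → X) (K : Set X) : Prop :=
  IsClosed K ∧
  ∃ f : ι × (ℤ × ℕ) × ℕ × ℕ × ℕ → Bool, Computable f ∧
    ∀ (i : ι) (c : ℤ × ℕ),
      (K ∩ Metric.closedBall (p i) ((ratOfCode c : ℚ) : ℝ)).Nonempty ↔
        ∀ y₁ : ℕ, ∃ y₂ : ℕ, ∀ y₃ : ℕ, f (i, c, y₁, y₂, y₃) = true

/-! ### Shift-invariant probability measures -/

/-- The shift map, `(σ x)_i = x_{i + 1}`. -/
def shift {A : Type*} (x : ℤ → A) : ℤ → A := fun i => x (i + 1)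

/-- The cylinder `[u]_U`. -/
def cylinderOn {A : Type*} (U : Finset ℤ) (u : U → A) : Set (ℤ → A) :=
  {x | ∀ i : U, x i = u i}

/-- The set `M(A^ℤ)` of shift-invariant Borel probability measures on `A^ℤ`. -/
structure ShiftMeasure (A : Type*) [MeasurableSpace A] where
  /-- the underlying measure -/
  toMeasure : Measure (ℤ → A)
  isProb : IsProbabilityMeasure toMeasure
  shift_inv : ∀ s : Set (ℤ → A), MeasurableSet s → toMeasure (shift ⁻¹' s) = toMeasure s

instance {A : Type*} [MeasurableSpace A] (μ : ShiftMeasure A) :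
    IsProbabilityMeasure μ.toMeasure := μ.isProb

/-- The window `⟦-n, n⟧`. -/
noncomputable def window (n : ℕ) : Finset ℤ := Finset.Icc (-(n : ℤ)) (n : ℤ)

theorem cylinderOn_eq_preimage {A : Type*} (U : Finset ℤ) (u : U → A) :
    cylinderOn U u = (U.restrict (π := fun _ : ℤ => A)) ⁻¹' ({u} : Set (U → A)) := by
  ext x
  exact funext_iff.symm

section Metric

variable {A : Type*} [Fintype A] [MeasurableSpace A]

/-- The total variation distance of two measures on the finite window `U`. -/
noncomputable def tvDist (U : Finset ℤ) (μ ν : ShiftMeasure A) : ℝ :=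
  (1 / 2 : ℝ) *
    ∑ u : U → A, |μ.toMeasure.real (cylinderOn U u) - ν.toMeasure.real (cylinderOn U u)|

/-- The distance `d_M`. -/
noncomputable def distM (μ ν : ShiftMeasure A) : ℝ :=
  ∑' n : ℕ, (1 / 2 : ℝ) ^ n * tvDist (window n) μ ν

theorem tvDist_nonneg (U : Finset ℤ) (μ ν : ShiftMeasure A) : 0 ≤ tvDist U μ ν :=
  mul_nonneg (by norm_num) (Finset.sum_nonneg fun _ _ => abs_nonneg _)

theorem tvDist_self (U : Finset ℤ) (μ : ShiftMeasure A) : tvDist U μ μ = 0 := by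
  simp [tvDist]

theorem tvDist_comm (U : Finset ℤ) (μ ν : ShiftMeasure A) : tvDist U μ ν = tvDist U ν μ := by
  simp only [tvDist, abs_sub_comm]

theorem tvDist_triangle (U : Finset ℤ) (μ ν ρ : ShiftMeasure A) :
    tvDist U μ ρ ≤ tvDist U μ ν + tvDist U ν ρ := by
  unfold tvDist
  rw [← mul_add, ← Finset.sum_add_distrib]
  gcongr
  exact abs_sub_le _ _ _

variable [DiscreteMeasurableSpace A]

theorem sum_cylinderOn (U : Finset ℤ) (μ : ShiftMeasure A) :
    ∑ u : U → A, μ.toMeasure.real (cylinderOn U u) = 1 := by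
  have h : IsProbabilityMeasure (μ.toMeasure.map U.restrict) :=
    Measure.isProbabilityMeasure_map (Finset.measurable_restrict U).aemeasurable
  have h1 : ∀ u : U → A, μ.toMeasure.real (cylinderOn U u)
      = (μ.toMeasure.map U.restrict).real ({u} : Set (U → A)) := by
    intro u
    rw [cylinderOn_eq_preimage, map_measureReal_apply (Finset.measurable_restrict U)
      (measurableSet_singleton u)]
  simp only [h1]
  rw [sum_measureReal_singleton]
  simp

theorem tvDist_le_one (U : Finset ℤ) (μ ν : ShiftMeasure A) : tvDist U μ ν ≤ 1 := by
  have h : ∑ u : U → A, |μ.toMeasure.real (cylinderOn U u) - ν.toMeasure.real (cylinderOn U u)|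
      ≤ ∑ u : U → A,
        (μ.toMeasure.real (cylinderOn U u) + ν.toMeasure.real (cylinderOn U u)) := by
    refine Finset.sum_le_sum fun u _ => ?_
    have h1 : 0 ≤ μ.toMeasure.real (cylinderOn U u) := measureReal_nonneg
    have h2 : 0 ≤ ν.toMeasure.real (cylinderOn U u) := measureReal_nonneg
    rw [abs_le]
    constructor <;> linarith
  rw [Finset.sum_add_distrib, sum_cylinderOn, sum_cylinderOn] at h
  unfold tvDist
  linarith

theorem summable_distM (μ ν : ShiftMeasure A) :
    Summable fun n : ℕ => (1 / 2 : ℝ) ^ n * tvDist (window n) μ ν := by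
  refine Summable.of_nonneg_of_le (fun n => mul_nonneg (by positivity) (tvDist_nonneg _ _ _))
    (fun n => ?_) summable_geometric_two
  exact mul_le_of_le_one_right (by positivity) (tvDist_le_one _ _ _)

theorem exists_subset_window (U : Finset ℤ) : ∃ n : ℕ, U ⊆ window n := by
  refine ⟨U.sup Int.natAbs, fun i hi => ?_⟩
  have h : i.natAbs ≤ U.sup Int.natAbs := Finset.le_sup (f := Int.natAbs) hi
  simp only [window, Finset.mem_Icc]
  omega

theorem eq_of_distM_eq_zero {μ ν : ShiftMeasure A} (h : distM μ ν = 0) : μ = ν := by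
  have hn : ∀ n : ℕ, tvDist (window n) μ ν = 0 := by
    intro n
    have h0 := (summable_distM μ ν).hasSum_iff.2 h
    rw [hasSum_zero_iff_of_nonneg
      (fun n => mul_nonneg (by positivity) (tvDist_nonneg _ _ _))] at h0
    have h1 : (1 / 2 : ℝ) ^ n * tvDist (window n) μ ν = 0 := congrFun h0 n
    exact (mul_eq_zero.1 h1).resolve_left (by positivity)
  have hw : ∀ n : ℕ, μ.toMeasure.map (window n).restrict
      = ν.toMeasure.map (window n).restrict := by
    intro n
    refine Measure.ext_of_singleton fun u => ?_
    have h1 : ∑ u : window n → A, |μ.toMeasure.real (cylinderOn _ u)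
        - ν.toMeasure.real (cylinderOn _ u)| = 0 := by
      have := hn n
      unfold tvDist at this
      linarith
    have h2 := (Finset.sum_eq_zero_iff_of_nonneg fun _ _ => abs_nonneg _).1 h1 u
      (Finset.mem_univ u)
    have h3 := sub_eq_zero.1 (abs_eq_zero.1 h2)
    rw [Measure.map_apply (Finset.measurable_restrict _) (measurableSet_singleton u),
      Measure.map_apply (Finset.measurable_restrict _) (measurableSet_singleton u),
      ← cylinderOn_eq_preimage]
    exact (measureReal_eq_measureReal_iff).1 h3
  have hU : ∀ U : Finset ℤ, ν.toMeasure.map U.restrict = μ.toMeasure.map U.restrict := by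
    intro U
    obtain ⟨n, hUn⟩ := exists_subset_window U
    rw [← Finset.restrict₂_comp_restrict hUn,
      ← Measure.map_map (Finset.measurable_restrict₂ hUn) (Finset.measurable_restrict _),
      ← Measure.map_map (Finset.measurable_restrict₂ hUn) (Finset.measurable_restrict _), hw n]
  have hm : μ.toMeasure = ν.toMeasure :=
    IsProjectiveLimit.unique (P := fun U : Finset ℤ => μ.toMeasure.map U.restrict)
      (fun _ => rfl) hU
  cases μ
  cases ν
  simp only [ShiftMeasure.mk.injEq]
  exact hm

noncomputable instance : MetricSpace (ShiftMeasure A) where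
  dist := distM
  dist_self μ := by
    simp [distM, tvDist_self]
  dist_comm μ ν := by
    simp only [distM, tvDist_comm]
  dist_triangle μ ν ρ := by
    unfold distM
    rw [← (summable_distM μ ν).tsum_add (summable_distM ν ρ)]
    refine (summable_distM μ ρ).tsum_le_tsum (fun n => ?_)
      ((summable_distM μ ν).add (summable_distM ν ρ))
    rw [← mul_add]
    exact mul_le_mul_of_nonneg_left (tvDist_triangle _ _ _ _) (by positivity)
  eq_of_dist_eq_zero h := eq_of_distM_eq_zero h

end Metric

/-! ### Periodic measures -/

section Periodic

variable {A : Type*}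

/-- The nonempty word with first letter `w.1` and remaining letters `w.2`. -/
def wordOf (w : A × List A) : List A := w.1 :: w.2

/-- The bi-infinite periodic configuration `⋯www⋯`, with a copy of `w` starting at position `0`. -/
def periodicConfig (w : A × List A) : ℤ → A :=
  fun i => (wordOf w).getD (i % ((wordOf w).length : ℤ)).toNat w.1

theorem periodicConfig_add_length (w : A × List A) (i : ℤ) :
    periodicConfig w (i + (wordOf w).length) = periodicConfig w i := by
  simp [periodicConfig]

/-- The measure `|w|⁻¹ ∑_{k < |w|} δ_{σ^k(⋯www⋯)}`, that is, the uniform measure on the orbit of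
the periodic configuration generated by `w`. -/
noncomputable def periodicMeasureAux [MeasurableSpace A] (w : A × List A) : Measure (ℤ → A) :=
  ((wordOf w).length : ENNReal)⁻¹ •
    ∑ k ∈ Finset.range (wordOf w).length, Measure.dirac (shift^[k] (periodicConfig w))

theorem shift_iterate (k : ℕ) (x : ℤ → A) (i : ℤ) : (shift^[k] x) i = x (i + k) := by
  induction k generalizing i with
  | zero => simp
  | succ k ih =>
    rw [Function.iterate_succ_apply']
    simp only [shift, ih]
    congr 1
    push_cast
    ring

theorem measurable_shift [MeasurableSpace A] : Measurable (shift : (ℤ → A) → ℤ → A) :=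
  measurable_pi_lambda _ fun i => measurable_pi_apply (i + 1)

/-- The shift-invariant probability measure supported by the periodic orbit generated by `w`. -/
noncomputable def periodicMeasure [MeasurableSpace A] (w : A × List A) : ShiftMeasure A where
  toMeasure := periodicMeasureAux w
  isProb := by
    constructor
    have h0 : ((wordOf w).length : ENNReal) ≠ 0 := by simp [wordOf]
    simp only [periodicMeasureAux, Measure.smul_apply, Measure.finsetSum_apply, measure_univ,
      Finset.sum_const, Finset.card_range, nsmul_eq_mul, mul_one, smul_eq_mul]
    exact ENNReal.inv_mul_cancel h0 (ENNReal.natCast_ne_top _)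
  shift_inv s hs := by
    have hp : shift^[(wordOf w).length] (periodicConfig w) = periodicConfig w := by
      funext i
      rw [shift_iterate, periodicConfig_add_length]
    simp only [periodicMeasureAux, Measure.smul_apply, Measure.finsetSum_apply]
    congr 1
    simp only [Measure.dirac_apply' _ hs, Measure.dirac_apply' _ (measurable_shift hs)]
    have h1 : ∀ k : ℕ, (shift ⁻¹' s).indicator (1 : (ℤ → A) → ENNReal)
        (shift^[k] (periodicConfig w))
        = s.indicator 1 (shift^[k + 1] (periodicConfig w)) := by
      intro k
      rw [Function.iterate_succ_apply']
      rfl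
    simp only [h1]
    have h2 := Finset.sum_range_succ
      (fun k => s.indicator (1 : (ℤ → A) → ENNReal) (shift^[k] (periodicConfig w)))
      (wordOf w).length
    have h3 := Finset.sum_range_succ'
      (fun k => s.indicator (1 : (ℤ → A) → ENNReal) (shift^[k] (periodicConfig w)))
      (wordOf w).length
    rw [h3, hp] at h2
    have h4 : s.indicator (1 : (ℤ → A) → ENNReal) (periodicConfig w) ≠ ⊤ := by
      by_cases hx : periodicConfig w ∈ s <;> simp [hx]
    exact (ENNReal.add_left_inj h4).1 h2

end Periodic

/-! ### Cellular automata, probabilistic cellular automata and perturbations -/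

/-- A cellular automaton over the alphabet `A`, given by its neighbourhood and its local rule. -/
structure CellularAutomaton (A : Type*) where
  /-- the neighbourhood -/
  nbhd : Finset ℤ
  /-- the local rule -/
  localRule : (nbhd → A) → A

/-- The local rule of a probabilistic cellular automaton with neighbourhood `N`: a stochastic
matrix. -/
structure StochasticRule (A : Type*) [Fintype A] (N : Finset ℤ) where
  /-- the entries of the matrix -/
  prob : (N → A) → A → unitInterval
  sum_prob : ∀ u : N → A, ∑ b : A, (prob u b : ℝ) = 1

section PCA

variable {A : Type*} [Fintype A]

/-- The pattern `x_{i + N}`. -/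
def patternAt (N : Finset ℤ) (x : ℤ → A) (i : ℤ) : N → A := fun j => x (i + j)

namespace StochasticRule

variable {N : Finset ℤ} [MeasurableSpace A]

/-- The distribution `φ(u, ·)` on the alphabet. -/
noncomputable def siteLaw (φ : StochasticRule A N) (u : N → A) : Measure A :=
  ∑ b : A, ENNReal.ofReal (φ.prob u b : ℝ) • Measure.dirac b

instance (φ : StochasticRule A N) (u : N → A) : IsProbabilityMeasure (φ.siteLaw u) := by
  constructor
  simp only [siteLaw, Measure.finsetSum_apply, Measure.smul_apply, measure_univ, smul_eq_mul,
    mul_one]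
  rw [← ENNReal.ofReal_sum_of_nonneg fun b _ => (φ.prob u b).2.1, φ.sum_prob u,
    ENNReal.ofReal_one]

/-- The transition kernel: given `x`, the new symbols are independent and the one at the site `i`
has law `φ(x_{i + N}, ·)`. -/
noncomputable def transition (φ : StochasticRule A N) (x : ℤ → A) : Measure (ℤ → A) :=
  Measure.infinitePi fun i : ℤ => φ.siteLaw (patternAt N x i)

/-- The set of shift-invariant probability measures `μ` with `Φ μ = μ`. -/
def invariantMeasures (φ : StochasticRule A N) : Set (ShiftMeasure A) :=
  {μ | ∀ s : Set (ℤ → A), MeasurableSet s →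
    ∫⁻ x, φ.transition x s ∂μ.toMeasure = μ.toMeasure s}

end StochasticRule

open Classical in
/-- A cellular automaton seen as a probabilistic one. -/
noncomputable def CellularAutomaton.toStochasticRule (F : CellularAutomaton A) :
    StochasticRule A F.nbhd where
  prob u a := if F.localRule u = a then 1 else 0
  sum_prob u := by simp [apply_ite]

/-- A perturbation `(F_ε)_{ε > 0}` of a cellular automaton `F`: for all `ε > 0`, `F_ε` has the same
neighbourhood as `F`, and its local rule gives the symbol prescribed by `F` a probability at least
`1 - ε`. -/
structure Perturbation (F : CellularAutomaton A) where
  /-- the local rule of `F_ε` -/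
  noisyRule : Set.Ioi (0 : ℝ) → StochasticRule A F.nbhd
  one_sub_le : ∀ (ε : Set.Ioi (0 : ℝ)) (u : F.nbhd → A),
    1 - (ε : ℝ) ≤ ((noisyRule ε).prob u (F.localRule u) : ℝ)

namespace Perturbation

variable {F : CellularAutomaton A}

open Classical in
/-- The local rule `f_ε` for `ε ≥ 0`, where `f_0` is the rule of `F`. -/
noncomputable def rule (P : Perturbation F) (ε : ℝ) : StochasticRule A F.nbhd :=
  if h : 0 < ε then P.noisyRule ⟨ε, h⟩ else F.toStochasticRule

/-- The perturbation is computable if `ε ↦ f_ε` is a computable map from `[0, 1]` to the finite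
power `[0, 1]^(A^N × A)`, that is, if each of its finitely many coordinates is computable. -/
def IsComputable (P : Perturbation F) : Prop :=
  ∀ (u : F.nbhd → A) (a : A),
    IsComputableMap unitRatOfCode unitRatOfCode
      fun ε : unitInterval => (P.rule (ε : ℝ)).prob u a

variable [MeasurableSpace A]

/-- The set `M_ε` of measures invariant under `F_ε` and the shift. -/
def invariantSet (P : Perturbation F) (ε : ℝ) : Set (ShiftMeasure A) :=
  (P.rule ε).invariantMeasures

variable [DiscreteMeasurableSpace A]

/-- The set of zero-noise limits of invariant measures: the accumulation points of `M_ε` as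
`ε → 0`. -/
def zeroNoiseLimits (P : Perturbation F) : Set (ShiftMeasure A) :=
  {μ | ∀ δ > (0 : ℝ), ∀ ε₀ > (0 : ℝ), ∃ ε : ℝ, 0 < ε ∧ ε < ε₀ ∧
    ∃ ν ∈ P.invariantSet ε, dist μ ν < δ}

/-- The set of stable measures: the limits, as `ε → 0`, of families `π_ε ∈ M_ε`, `ε > 0`. -/
def stableMeasures (P : Perturbation F) : Set (ShiftMeasure A) :=
  {ν | ∃ π : ℝ → ShiftMeasure A, (∀ ε > (0 : ℝ), π ε ∈ P.invariantSet ε) ∧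
    Tendsto π (𝓝[>] (0 : ℝ)) (𝓝 ν)}

end Perturbation

end PCA

end NoisyCA

/-! The core is `exists_test`: for computable rational data a, b, r and a computable family of
measures q, the existence of ε in [a, b] and of an F_ε-invariant ν with d(ν, q) ≤ r is a Π₁
property. The reason is compactness. The pairs (ε, ν) with ν invariant under F_ε and the shift form
a compact set, since ε ↦ f_ε is continuous on [0, 1] and invariance amounts to countably many
equations between integrals of functions of finitely many sites (`mem_invariantMeasures_iff`). A
test at level k searches a finite grid of parameters and of finitely supported rational measures for
a candidate that satisfies the first constraints up to 2⁻ᵏ. A genuine pair, once rounded, passes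
every test (`exists_atomic`, `isAlmostInvariant_of_ellDist_le`). Conversely, candidates passing all
tests have a limit along an ultrafilter, which is a genuine pair
(`exists_invariant_of_isAlmostInvariant`).

A closed ball of radius r around q meets the zero-noise limits iff for every n there is an m such
that some ε in [1/(m+1), 1/(n+1)] has an invariant measure within r + 1/(n+1) of q. The bound by m
keeps ε positive while the interval stays compact, so `exists_test` supplies the last universal
quantifier.

A measure ν is stable iff the distance from ν to M_ε tends to 0 (`mem_stableMeasures_iff`); this
uses that M_ε is never empty (`StochasticRule.invariantMeasures_nonempty`). The ball meets the
stable measures iff for every n some finitely supported measure within r + 1/(n+1) of q is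
1/(n+1)-close to M_ε for all small ε > 0. The finitely supported measure turns the existential
quantifier into one over ℕ. Rational ε suffice, because the parameters with an invariant measure in
a given ball form a closed set (`exists_invariant_near_of_rat`). What remains is universal over Π₁
conditions.

The finitely supported measures are not shift-invariant, so the distance is extended to all measures
by `measureDist`. To make the tests arithmetic, ℤ is enumerated as 0, -1, 1, -2, 2, …, and a
cylinder on the first m sites is coded by a number written in base |A|. -/

set_option linter.unusedSectionVars false

namespace NoisyCA

/-! ### Computable rational-valued functions and decidable predicates -/

attribute [fun_prop] Computable
attribute [fun_prop] Computable.id Computable.const Computable.pair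

section Computability

variable {α β σ : Type*} [Primcodable α] [Primcodable β] [Primcodable σ]

@[fun_prop]
theorem computable_comp {f : β → σ} {g : α → β} (hf : Computable f) (hg : Computable g) :
    Computable fun a => f (g a) := hf.comp hg

@[fun_prop]
theorem computable_fst {f : α → β × σ} (hf : Computable f) : Computable fun a => (f a).1 :=
  Computable.fst.comp hf

@[fun_prop]
theorem computable_snd {f : α → β × σ} (hf : Computable f) : Computable fun a => (f a).2 :=
  Computable.snd.comp hf

@[fun_prop]
theorem computable_add {f g : α → ℕ} (hf : Computable f) (hg : Computable g) :
    Computable fun a => f a + g a := (Primrec.nat_add.to_comp).comp hf hg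

@[fun_prop]
theorem computable_mul {f g : α → ℕ} (hf : Computable f) (hg : Computable g) :
    Computable fun a => f a * g a := (Primrec.nat_mul.to_comp).comp hf hg

@[fun_prop]
theorem computable_sub {f g : α → ℕ} (hf : Computable f) (hg : Computable g) :
    Computable fun a => f a - g a := (Primrec.nat_sub.to_comp).comp hf hg

@[fun_prop]
theorem computable_div {f g : α → ℕ} (hf : Computable f) (hg : Computable g) :
    Computable fun a => f a / g a := (Primrec.nat_div.to_comp).comp hf hg

@[fun_prop]
theorem computable_mod {f g : α → ℕ} (hf : Computable f) (hg : Computable g) :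
    Computable fun a => f a % g a := (Primrec.nat_mod.to_comp).comp hf hg

theorem computable_nat_rec {f : α → ℕ} {g : α → σ} {h : α → ℕ → σ → σ} (hf : Computable f)
    (hg : Computable g) (hh : Computable fun p : (α × ℕ) × σ => h p.1.1 p.1.2 p.2) :
    Computable fun a => (Nat.rec (g a) (fun n s => h a n s) (f a) : σ) := by
  refine Computable.nat_rec (h := fun a p => h a p.1 p.2) hf hg ?_
  have h1 : Computable fun p : α × (ℕ × σ) => ((p.1, p.2.1), p.2.2) := by fun_prop
  exact hh.comp h1

@[fun_prop]
theorem computable_pow {f g : α → ℕ} (hf : Computable f) (hg : Computable g) :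
    Computable fun a => f a ^ g a := by
  refine (computable_nat_rec (h := fun a _ s => s * f a) hg (Computable.const 1)
    (by fun_prop)).of_eq fun a => ?_
  induction g a with
  | zero => simp
  | succ n ih => simp only [ih, pow_succ]

@[fun_prop]
theorem computable_sum_range {f : α → ℕ → ℕ} {n : α → ℕ}
    (hf : Computable fun p : α × ℕ => f p.1 p.2) (hn : Computable n) :
    Computable fun a => ∑ i ∈ Finset.range (n a), f a i := by
  have h1 : Computable fun p : (α × ℕ) × ℕ => p.2 + f p.1.1 p.1.2 :=
    computable_add Computable.snd (hf.comp Computable.fst)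
  refine (computable_nat_rec (h := fun a i s => s + f a i) hn (Computable.const 0) h1).of_eq
    fun a => ?_
  induction n a with
  | zero => simp
  | succ n ih => simp only [ih, Finset.sum_range_succ]

@[fun_prop]
theorem computable_fintype_sum {κ : Type*} (s : Finset κ) {f : κ → α → ℕ}
    (hf : ∀ i, Computable (f i)) : Computable fun a => ∑ i ∈ s, f i a := by
  classical
  induction s using Finset.induction_on with
  | empty => simpa using Computable.const 0
  | insert i s hi ih =>
    simp only [Finset.sum_insert hi]
    exact computable_add (hf i) ih

theorem computable_of_finite [Finite β] {f : β → σ} {g : α → β} (hg : Computable g) :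
    Computable fun a => f (g a) := (Primrec.dom_finite f).to_comp.comp hg

theorem computable_listGetD {f : α → List σ} {g : α → ℕ} {h : α → σ} (hf : Computable f)
    (hg : Computable g) (hh : Computable h) : Computable fun a => (f a).getD (g a) (h a) := by
  have h1 : Computable fun a => ((f a)[g a]?).getD (h a) :=
    Computable.option_getD (Computable.list_getElem?.comp hf hg) hh
  exact h1.of_eq fun a => by simp

@[fun_prop]
theorem computable_listLength {f : α → List σ} (hf : Computable f) :
    Computable fun a => (f a).length := Computable.list_length.comp hf

@[fun_prop]
theorem computable_cons {f : α → σ} {g : α → List σ} (hf : Computable f) (hg : Computable g) :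
    Computable fun a => f a :: g a := Computable.list_cons.comp hf hg

/-! ### Decidable predicates -/

theorem computablePred_comp {p : β → Prop} (hp : ComputablePred p) {g : α → β}
    (hg : Computable g) : ComputablePred fun a => p (g a) := by
  obtain ⟨f, hf, rfl⟩ := ComputablePred.computable_iff.1 hp
  exact ComputablePred.computable_iff.2 ⟨fun a => f (g a), hf.comp hg, rfl⟩

theorem computablePred_and {p q : α → Prop} (hp : ComputablePred p) (hq : ComputablePred q) :
    ComputablePred fun a => p a ∧ q a := by
  obtain ⟨f, hf, rfl⟩ := ComputablePred.computable_iff.1 hp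
  obtain ⟨g, hg, rfl⟩ := ComputablePred.computable_iff.1 hq
  exact ComputablePred.computable_iff.2
    ⟨fun a => f a && g a, (Primrec.and.to_comp).comp hf hg, by simp⟩

theorem computablePred_imp {p q : α → Prop} (hp : ComputablePred p) (hq : ComputablePred q) :
    ComputablePred fun a => p a → q a := by
  refine (computablePred_and hp hq.not).not.of_eq fun a => ?_
  tauto

theorem computablePred_le {f g : α → ℕ} (hf : Computable f) (hg : Computable g) :
    ComputablePred fun a => f a ≤ g a :=
  computablePred_comp (p := fun x : ℕ × ℕ => x.1 ≤ x.2)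
    (Primrec.nat_le).computablePred (g := fun a => (f a, g a)) (hf.pair hg)

theorem computablePred_eq {f g : α → ℕ} (hf : Computable f) (hg : Computable g) :
    ComputablePred fun a => f a = g a :=
  (computablePred_and (computablePred_le hf hg) (computablePred_le hg hf)).of_eq fun _ =>
    le_antisymm_iff.symm

theorem computable_ite {p : α → Prop} [DecidablePred p] {f g : α → σ} (hp : ComputablePred p)
    (hf : Computable f) (hg : Computable g) : Computable fun a => if p a then f a else g a := by
  refine (Computable.cond hp.decide hf hg).of_eq fun a => ?_
  by_cases h : p a <;> simp [h]

/-- A bounded search succeeds iff its number of successes, a computable finite sum, is at least 1.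
-/
theorem computablePred_exists_lt {p : α → ℕ → Prop} {n : α → ℕ}
    (hp : ComputablePred fun x : α × ℕ => p x.1 x.2) (hn : Computable n) :
    ComputablePred fun a => ∃ i < n a, p a i := by
  classical
  have h1 : Computable fun x : α × ℕ => if p x.1 x.2 then 1 else 0 :=
    computable_ite hp (Computable.const 1) (Computable.const 0)
  have h2 := computable_sum_range (f := fun a i => if p a i then 1 else 0) h1 hn
  refine (computablePred_le (Computable.const 1) h2).of_eq fun a => ?_
  rw [Nat.one_le_iff_ne_zero, Ne, Finset.sum_eq_zero_iff]
  simp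

theorem computablePred_forall_lt {p : α → ℕ → Prop} {n : α → ℕ}
    (hp : ComputablePred fun x : α × ℕ => p x.1 x.2) (hn : Computable n) :
    ComputablePred fun a => ∀ i < n a, p a i := by
  refine (computablePred_exists_lt (p := fun a i => ¬ p a i) hp.not hn).not.of_eq fun a => ?_
  push Not
  rfl

/-! ### Computable rational-valued functions -/

/-- The function `f` takes rational values, which are given by computable fractions. -/
def IsRatComputable (f : α → ℝ) : Prop :=
  ∃ p m d : α → ℕ, Computable p ∧ Computable m ∧ Computable d ∧
    ∀ a, f a = ((p a : ℝ) - m a) / ((d a : ℝ) + 1)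

namespace IsRatComputable

theorem of_eq {f g : α → ℝ} (hf : IsRatComputable f) (h : ∀ a, f a = g a) : IsRatComputable g :=
  (funext h : f = g) ▸ hf

theorem comp {f : β → ℝ} (hf : IsRatComputable f) {g : α → β} (hg : Computable g) :
    IsRatComputable fun a => f (g a) := by
  obtain ⟨p, m, d, hp, hm, hd, h⟩ := hf
  exact ⟨fun a => p (g a), fun a => m (g a), fun a => d (g a), hp.comp hg, hm.comp hg,
    hd.comp hg, fun a => h _⟩

theorem natCast {f : α → ℕ} (hf : Computable f) : IsRatComputable fun a => (f a : ℝ) :=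
  ⟨f, fun _ => 0, fun _ => 0, hf, Computable.const 0, Computable.const 0, fun a => by simp⟩

theorem neg {f : α → ℝ} (hf : IsRatComputable f) : IsRatComputable fun a => -f a := by
  obtain ⟨p, m, d, hp, hm, hd, h⟩ := hf
  exact ⟨m, p, d, hm, hp, hd, fun a => by simp only [h]; ring⟩

theorem add {f g : α → ℝ} (hf : IsRatComputable f) (hg : IsRatComputable g) :
    IsRatComputable fun a => f a + g a := by
  obtain ⟨p, m, d, hp, hm, hd, h⟩ := hf
  obtain ⟨p', m', d', hp', hm', hd', h'⟩ := hg
  refine ⟨fun a => p a * (d' a + 1) + p' a * (d a + 1), fun a => m a * (d' a + 1) + m' a * (d a + 1),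
    fun a => d a * d' a + d a + d' a, by fun_prop, by fun_prop, by fun_prop, fun a => ?_⟩
  have h1 : (d a : ℝ) + 1 ≠ 0 := by positivity
  have h2 : (d' a : ℝ) + 1 ≠ 0 := by positivity
  have h3 : (d a : ℝ) * d' a + d a + d' a + 1 = (d a + 1) * (d' a + 1) := by ring
  simp only [h, h']
  push_cast
  rw [h3]
  field_simp
  ring

theorem sub {f g : α → ℝ} (hf : IsRatComputable f) (hg : IsRatComputable g) :
    IsRatComputable fun a => f a - g a :=
  (hf.add hg.neg).of_eq fun _ => (sub_eq_add_neg _ _).symm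

theorem mul {f g : α → ℝ} (hf : IsRatComputable f) (hg : IsRatComputable g) :
    IsRatComputable fun a => f a * g a := by
  obtain ⟨p, m, d, hp, hm, hd, h⟩ := hf
  obtain ⟨p', m', d', hp', hm', hd', h'⟩ := hg
  refine ⟨fun a => p a * p' a + m a * m' a, fun a => p a * m' a + m a * p' a,
    fun a => d a * d' a + d a + d' a, by fun_prop, by fun_prop, by fun_prop, fun a => ?_⟩
  have h1 : (d a : ℝ) + 1 ≠ 0 := by positivity
  have h2 : (d' a : ℝ) + 1 ≠ 0 := by positivity
  have h3 : (d a : ℝ) * d' a + d a + d' a + 1 = (d a + 1) * (d' a + 1) := by ring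
  simp only [h, h']
  push_cast
  rw [h3]
  field_simp
  ring

theorem ite {p : α → Prop} [DecidablePred p] {f g : α → ℝ} (hp : ComputablePred p)
    (hf : IsRatComputable f) (hg : IsRatComputable g) :
    IsRatComputable fun a => if p a then f a else g a := by
  obtain ⟨p₁, m, d, hp₁, hm, hd, h⟩ := hf
  obtain ⟨p', m', d', hp', hm', hd', h'⟩ := hg
  refine ⟨_, _, _, computable_ite hp hp₁ hp', computable_ite hp hm hm', computable_ite hp hd hd',
    fun a => ?_⟩
  by_cases hpa : p a <;> simp [hpa, h, h']

theorem indicator {p : α → Prop} [DecidablePred p] (hp : ComputablePred p) :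
    IsRatComputable fun a => if p a then (1 : ℝ) else 0 :=
  ite hp ((natCast (Computable.const 1)).of_eq fun _ => by simp)
    ((natCast (Computable.const 0)).of_eq fun _ => by simp)

theorem inv_natCast {g : α → ℕ} (hg : Computable g) :
    IsRatComputable fun a => ((g a : ℝ))⁻¹ := by
  -- The numerator 0 accounts for the convention `0⁻¹ = 0`.
  refine ⟨fun a => if g a = 0 then 0 else 1, fun _ => 0, fun a => g a - 1,
    computable_ite (computablePred_eq hg (Computable.const 0)) (by fun_prop) (by fun_prop),
    by fun_prop, by fun_prop, fun a => ?_⟩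
  rcases Nat.eq_zero_or_pos (g a) with h | h
  · simp [h]
  · rw [Nat.cast_sub h]
    simp [h.ne']

theorem half_pow {g : α → ℕ} (hg : Computable g) :
    IsRatComputable fun a => (1 / 2 : ℝ) ^ g a :=
  (inv_natCast (g := fun a => 2 ^ g a) (by fun_prop)).of_eq fun a => by simp

theorem abs {f : α → ℝ} (hf : IsRatComputable f) : IsRatComputable fun a => |f a| := by
  obtain ⟨p, m, d, hp, hm, hd, h⟩ := hf
  -- Subtraction is truncated: one of the two terms vanishes and the other is the absolute value.
  refine ⟨fun a => (p a - m a) + (m a - p a), fun _ => 0, d, by fun_prop, by fun_prop, hd,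
    fun a => ?_⟩
  have h1 : (0 : ℝ) < (d a : ℝ) + 1 := by positivity
  simp only [h]
  rw [abs_div, abs_of_pos h1]
  congr 1
  rcases le_total (p a) (m a) with hle | hle
  · rw [abs_of_nonpos (sub_nonpos.2 (by exact_mod_cast hle)), Nat.sub_eq_zero_of_le hle]
    push_cast [hle]
    ring
  · rw [abs_of_nonneg (sub_nonneg.2 (by exact_mod_cast hle)), Nat.sub_eq_zero_of_le hle]
    push_cast [hle]
    ring

theorem finset_sum {κ : Type*} (s : Finset κ) {f : κ → α → ℝ}
    (hf : ∀ i, IsRatComputable (f i)) : IsRatComputable fun a => ∑ i ∈ s, f i a := by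
  classical
  induction s using Finset.induction_on with
  | empty => exact (natCast (Computable.const 0)).of_eq fun _ => by simp
  | insert i s hi ih => exact ((hf i).add ih).of_eq fun a => by rw [Finset.sum_insert hi]

theorem finset_prod {κ : Type*} (s : Finset κ) {f : κ → α → ℝ}
    (hf : ∀ i, IsRatComputable (f i)) : IsRatComputable fun a => ∏ i ∈ s, f i a := by
  classical
  induction s using Finset.induction_on with
  | empty => exact (natCast (Computable.const 1)).of_eq fun _ => by simp
  | insert i s hi ih => exact ((hf i).mul ih).of_eq fun a => by rw [Finset.prod_insert hi]

/-- The value of the fraction with numerator `t.1 - t.2.1` and denominator `t.2.2 + 1`. -/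
noncomputable def fracVal (t : ℕ × ℕ × ℕ) : ℝ := ((t.1 : ℝ) - t.2.1) / ((t.2.2 : ℝ) + 1)

theorem fracVal_isRatComputable : IsRatComputable fracVal :=
  ⟨fun t => t.1, fun t => t.2.1, fun t => t.2.2, by fun_prop, by fun_prop, by fun_prop,
    fun _ => rfl⟩

theorem exists_fracVal {f : α → ℝ} (hf : IsRatComputable f) :
    ∃ t : α → ℕ × ℕ × ℕ, Computable t ∧ ∀ a, f a = fracVal (t a) := by
  obtain ⟨p, m, d, hp, hm, hd, h⟩ := hf
  exact ⟨fun a => (p a, m a, d a), by fun_prop, h⟩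

/-- Functions defined by recursion over the natural numbers. -/
theorem nat_rec {F : α → ℕ → ℝ} {h : α → ℕ → ℝ → ℝ} {n : α → ℕ} (hn : Computable n)
    (h0 : IsRatComputable fun a => F a 0) (hF : ∀ a i, F a (i + 1) = h a i (F a i))
    (hh : IsRatComputable fun p : (α × ℕ) × (ℕ × ℕ × ℕ) => h p.1.1 p.1.2 (fracVal p.2)) :
    IsRatComputable fun a => F a (n a) := by
  obtain ⟨t, ht, htF⟩ := h0.exists_fracVal
  obtain ⟨r, hr, hrh⟩ := hh.exists_fracVal
  -- The recursion runs on codes of fractions; `r` turns a code of the current value into a code of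
  -- the next one.
  have h1 := computable_nat_rec (h := fun a i s => r ((a, i), s)) hn ht hr
  refine (fracVal_isRatComputable.comp h1).of_eq fun a => ?_
  induction n a with
  | zero => exact (htF a).symm
  | succ k ih => rw [hF, ← ih, hrh ((a, k), _)]

theorem sum_range {f : α → ℕ → ℝ} {n : α → ℕ}
    (hf : IsRatComputable fun p : α × ℕ => f p.1 p.2) (hn : Computable n) :
    IsRatComputable fun a => ∑ i ∈ Finset.range (n a), f a i := by
  refine nat_rec (F := fun a k => ∑ i ∈ Finset.range k, f a i) (h := fun a i s => s + f a i) hn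
    ((natCast (Computable.const 0)).of_eq fun _ => by simp) (fun a i => Finset.sum_range_succ _ _)
    ((fracVal_isRatComputable.comp Computable.snd).add (hf.comp Computable.fst))

theorem prod_range {f : α → ℕ → ℝ} {n : α → ℕ}
    (hf : IsRatComputable fun p : α × ℕ => f p.1 p.2) (hn : Computable n) :
    IsRatComputable fun a => ∏ i ∈ Finset.range (n a), f a i := by
  refine nat_rec (F := fun a k => ∏ i ∈ Finset.range k, f a i) (h := fun a i s => s * f a i) hn
    ((natCast (Computable.const 1)).of_eq fun _ => by simp) (fun a i => Finset.prod_range_succ _ _)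
    ((fracVal_isRatComputable.comp Computable.snd).mul (hf.comp Computable.fst))

theorem computablePred_le {f g : α → ℝ} (hf : IsRatComputable f) (hg : IsRatComputable g) :
    ComputablePred fun a => f a ≤ g a := by
  obtain ⟨p, m, d, hp, hm, hd, h⟩ := hf
  obtain ⟨p', m', d', hp', hm', hd', h'⟩ := hg
  refine (NoisyCA.computablePred_le (f := fun a => p a * (d' a + 1) + m' a * (d a + 1))
    (g := fun a => p' a * (d a + 1) + m a * (d' a + 1)) (by fun_prop) (by fun_prop)).of_eq
    fun a => ?_
  have h1 : (0 : ℝ) < (d a : ℝ) + 1 := by positivity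
  have h2 : (0 : ℝ) < (d' a : ℝ) + 1 := by positivity
  rw [h, h', div_le_div_iff₀ h1 h2, ← Nat.cast_le (α := ℝ)]
  push_cast
  constructor <;> intro h <;> linarith

theorem computablePred_lt {f g : α → ℝ} (hf : IsRatComputable f) (hg : IsRatComputable g) :
    ComputablePred fun a => f a < g a :=
  (hg.computablePred_le hf).not.of_eq fun _ => not_le

end IsRatComputable

theorem isRatComputable_ratOfCode :
    IsRatComputable fun c : ℤ × ℕ => ((ratOfCode c : ℚ) : ℝ) := by
  -- The encoding of ℤ sends z ≥ 0 to 2z and -(z+1) to 2z+1, so the parity of the code gives the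
  -- sign.
  have he : Computable fun c : ℤ × ℕ => Encodable.encode c.1 :=
    Computable.encode.comp Computable.fst
  have h2 : ComputablePred fun c : ℤ × ℕ => Encodable.encode c.1 % 2 = 0 :=
    computablePred_eq (by fun_prop) (by fun_prop)
  refine ⟨fun c => if Encodable.encode c.1 % 2 = 0 then Encodable.encode c.1 / 2 else 0,
    fun c => if Encodable.encode c.1 % 2 = 0 then 0 else Encodable.encode c.1 / 2 + 1,
    fun c => c.2, computable_ite h2 (by fun_prop) (by fun_prop),
    computable_ite h2 (by fun_prop) (by fun_prop), by fun_prop, fun c => ?_⟩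
  obtain ⟨z, q⟩ := c
  rcases z with z | z
  · have : Encodable.encode (Int.ofNat z) = 2 * z := rfl
    simp only [this]
    have h3 : 2 * z % 2 = 0 := by omega
    have h4 : 2 * z / 2 = z := by omega
    simp [h3, h4, ratOfCode]
  · have : Encodable.encode (Int.negSucc z) = 2 * z + 1 := rfl
    simp only [this]
    have h3 : (2 * z + 1) % 2 ≠ 0 := by omega
    have h4 : (2 * z + 1) / 2 = z := by omega
    simp only [h3, h4, if_false, ratOfCode]
    push_cast [Int.negSucc_eq]
    ring

theorem isRatComputable_unitRatOfCode :
    IsRatComputable fun c : ℕ × ℕ => ((unitRatOfCode c : unitInterval) : ℝ) := by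
  refine ⟨fun c => if c.1 ≤ c.2 + 1 then c.1 else c.2 + 1, fun _ => 0, fun c => c.2,
    computable_ite (computablePred_le (by fun_prop) (by fun_prop)) (by fun_prop) (by fun_prop),
    by fun_prop, by fun_prop, fun c => ?_⟩
  simp only [unitRatOfCode, min_def]
  split_ifs <;> simp

end Computability
/-! ### Coding of sites, configurations and cylinders by natural numbers -/

/-- The site with number `j`, in the enumeration `0, -1, 1, -2, 2, …`. -/
def site (j : ℕ) : ℤ := if j % 2 = 0 then ((j / 2 : ℕ) : ℤ) else -((j / 2 : ℕ) : ℤ) - 1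

/-- The number of a site. -/
def cell (z : ℤ) : ℕ := if 0 ≤ z then (2 * z).toNat else (-2 * z - 1).toNat

theorem cell_site (j : ℕ) : cell (site j) = j := by
  unfold cell site
  split_ifs <;> omega

theorem site_cell (z : ℤ) : site (cell z) = z := by
  unfold cell site
  split_ifs <;> omega

theorem site_injective : Function.Injective site := Function.LeftInverse.injective cell_site

theorem cell_site_add_lt (j : ℕ) (t : ℤ) : cell (site j + t) < j + 2 * t.natAbs + 2 := by
  unfold cell site
  split_ifs <;> omega

/-- The enumeration alternates sides so that symmetric windows become initial segments. -/
theorem mem_window_iff (n : ℕ) (z : ℤ) : z ∈ window n ↔ cell z < 2 * n + 1 := by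
  simp only [window, Finset.mem_Icc]
  unfold cell
  split_ifs <;> omega

section Coding

variable {A : Type*} [Fintype A] [Nonempty A]

/-- The number of a letter. -/
noncomputable def num (a : A) : ℕ := Fintype.equivFin A a

/-- The letter with a given number, modulo the number of letters. -/
noncomputable def letter (n : ℕ) : A :=
  (Fintype.equivFin A).symm ⟨n % Fintype.card A, Nat.mod_lt _ Fintype.card_pos⟩

theorem num_lt (a : A) : num a < Fintype.card A := (Fintype.equivFin A a).2

theorem num_injective : Function.Injective (num : A → ℕ) := fun _ _ h =>
  (Fintype.equivFin A).injective (Fin.ext h)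

theorem num_letter (n : ℕ) : num (letter n : A) = n % Fintype.card A := by
  simp [num, letter]

/-- The configuration whose letters are the digits of `v`. -/
noncomputable def conf (v : ℕ) : ℤ → A := fun i => letter (v / Fintype.card A ^ cell i)

theorem conf_site (v j : ℕ) : (conf v : ℤ → A) (site j) = letter (v / Fintype.card A ^ j) := by
  simp only [conf, cell_site]

/-- The set of configurations that agree with `conf v` at the first `m` sites. -/
def cyl (m v : ℕ) : Set (ℤ → A) := {x | ∀ j < m, x (site j) = conf v (site j)}

theorem conf_mem_cyl (m v : ℕ) : (conf v : ℤ → A) ∈ cyl m v := fun _ _ => rfl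

/-- Digits in base `c` can be prescribed. -/
theorem exists_digits {c : ℕ} (m : ℕ) (d : ℕ → ℕ) (hd : ∀ j, d j < c) :
    ∃ v < c ^ m, ∀ j < m, v / c ^ j % c = d j := by
  refine ⟨finFunctionFinEquiv fun j : Fin m => ⟨d j, hd j⟩, Fin.is_lt _, fun j hj => ?_⟩
  have h := congrFun (finFunctionFinEquiv.symm_apply_apply fun j : Fin m => (⟨d j, hd j⟩ : Fin c))
    ⟨j, hj⟩
  have h2 := congrArg Fin.val h
  rwa [finFunctionFinEquiv_symm_apply_val] at h2

theorem eq_of_digits {c m v w : ℕ} (hv : v < c ^ m) (hw : w < c ^ m)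
    (h : ∀ j < m, v / c ^ j % c = w / c ^ j % c) : v = w := by
  have h1 : (⟨v, hv⟩ : Fin (c ^ m)) = ⟨w, hw⟩ := by
    apply finFunctionFinEquiv.symm.injective
    funext j
    apply Fin.ext
    simpa using h j j.2
  exact congrArg Fin.val h1

/-- Together with `eq_of_mem_cyl`, this says that the codes below |A|^m index a partition into
cylinders. Larger codes only repeat these cylinders, because digits beyond the first m are ignored.
-/
theorem exists_mem_cyl (m : ℕ) (x : ℤ → A) : ∃ v < Fintype.card A ^ m, x ∈ cyl m v := by
  obtain ⟨v, hv, h⟩ := exists_digits m (fun j => num (x (site j))) fun j => num_lt _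
  refine ⟨v, hv, fun j hj => num_injective ?_⟩
  rw [conf_site, num_letter, h j hj]

theorem eq_of_mem_cyl {m v w : ℕ} {x : ℤ → A} (hv : v < Fintype.card A ^ m)
    (hw : w < Fintype.card A ^ m) (h : x ∈ cyl m v) (h' : x ∈ cyl m w) : v = w := by
  refine eq_of_digits hv hw fun j hj => ?_
  have h1 := congrArg num ((h j hj).symm.trans (h' j hj))
  rwa [conf_site, conf_site, num_letter, num_letter] at h1

/-- The value `h x` depends only on the first `L` letters of `x`. -/
def IsLocal {β : Type*} (L : ℕ) (h : (ℤ → A) → β) : Prop :=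
  ∀ x y : ℤ → A, (∀ j < L, x (site j) = y (site j)) → h x = h y

theorem IsLocal.mono {β : Type*} {L L' : ℕ} {h : (ℤ → A) → β} (hh : IsLocal L h) (hL : L ≤ L') :
    IsLocal L' h := fun x y hxy => hh x y fun j hj => hxy j (hj.trans_le hL)

theorem isLocal_cyl (m v : ℕ) : IsLocal m fun x : ℤ → A => x ∈ cyl m v := by
  intro x y h
  refine propext (forall₂_congr fun j hj => ?_)
  rw [h j hj]

theorem IsLocal.eq_conf {β : Type*} {L v : ℕ} {h : (ℤ → A) → β} (hh : IsLocal L h) {x : ℤ → A}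
    (hx : x ∈ cyl L v) : h x = h (conf v) := hh _ _ hx

/-- A local function is a finite combination of indicators of cylinders. -/
theorem IsLocal.eq_sum {L : ℕ} {h : (ℤ → A) → ℝ} (hh : IsLocal L h) (x : ℤ → A) :
    h x = ∑ v ∈ Finset.range (Fintype.card A ^ L), (cyl L v).indicator (fun _ => h (conf v)) x := by
  obtain ⟨v, hv, hx⟩ := exists_mem_cyl L x
  rw [Finset.sum_eq_single v]
  · rw [indicator_of_mem hx, hh.eq_conf hx]
  · intro w hw hne
    rw [indicator_of_notMem]
    exact fun hx' => hne (eq_of_mem_cyl (Finset.mem_range.1 hw) hv hx' hx)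
  · exact fun h => absurd (Finset.mem_range.2 hv) h

variable [MeasurableSpace A] [DiscreteMeasurableSpace A]

theorem measurableSet_cyl (m v : ℕ) : MeasurableSet (cyl m v : Set (ℤ → A)) := by
  have : (cyl m v : Set (ℤ → A))
      = ⋂ j ∈ Finset.range m, (fun x : ℤ → A => x (site j)) ⁻¹' {conf v (site j)} := by
    ext x
    simp [cyl]
  rw [this]
  exact Finset.measurableSet_biInter _ fun j _ =>
    measurable_pi_apply (site j) (MeasurableSet.of_discrete)

theorem IsLocal.measurable {L : ℕ} {h : (ℤ → A) → ℝ} (hh : IsLocal L h) : Measurable h := by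
  rw [funext hh.eq_sum]
  exact Finset.measurable_sum _ fun v _ => measurable_const.indicator (measurableSet_cyl L v)

theorem IsLocal.integrable {L : ℕ} {h : (ℤ → A) → ℝ} (hh : IsLocal L h) (μ : Measure (ℤ → A))
    [IsFiniteMeasure μ] : Integrable h μ := by
  rw [funext hh.eq_sum]
  exact integrable_finsetSum _ fun v _ =>
    (integrable_const _).indicator (measurableSet_cyl L v)

/-- The integral of a local function is a finite linear form in the masses of cylinders. Limits and
error estimates are reduced to such sums. -/
theorem IsLocal.integral_eq {L : ℕ} {h : (ℤ → A) → ℝ} (hh : IsLocal L h) (μ : Measure (ℤ → A))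
    [IsFiniteMeasure μ] :
    ∫ x, h x ∂μ = ∑ v ∈ Finset.range (Fintype.card A ^ L), μ.real (cyl L v) * h (conf v) := by
  conv_lhs => rw [funext hh.eq_sum]
  rw [integral_finsetSum _ fun v _ => (integrable_const _).indicator (measurableSet_cyl L v)]
  refine Finset.sum_congr rfl fun v _ => ?_
  rw [integral_indicator (measurableSet_cyl L v), setIntegral_const, smul_eq_mul]

open Classical in
theorem isLocal_indicator {L : ℕ} {s : Set (ℤ → A)} (hs : IsLocal L fun x => x ∈ s) :
    IsLocal L fun x => if x ∈ s then (1 : ℝ) else 0 := by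
  intro x y h
  have h1 : (x ∈ s) = (y ∈ s) := hs x y h
  simp only [h1]

theorem IsLocal.measurableSet {L : ℕ} {s : Set (ℤ → A)} (hs : IsLocal L fun x => x ∈ s) :
    MeasurableSet s := by
  classical
  have h1 := (isLocal_indicator hs).measurable (measurableSet_singleton (1 : ℝ))
  convert h1 using 1
  ext x
  simp

open Classical in
theorem measureReal_eq_integral {s : Set (ℤ → A)} (hs : MeasurableSet s) (μ : Measure (ℤ → A)) :
    μ.real s = ∫ x, (if x ∈ s then (1 : ℝ) else 0) ∂μ := by
  have : (fun x : ℤ → A => if x ∈ s then (1 : ℝ) else 0) = s.indicator 1 := by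
    funext x
    simp [indicator]
  rw [this, integral_indicator_one hs]

open Classical in
theorem IsLocal.measureReal_eq {L : ℕ} {s : Set (ℤ → A)} (hs : IsLocal L fun x => x ∈ s)
    (μ : Measure (ℤ → A)) [IsFiniteMeasure μ] :
    μ.real s = ∑ v ∈ Finset.range (Fintype.card A ^ L),
      μ.real (cyl L v) * if (conf v : ℤ → A) ∈ s then 1 else 0 := by
  rw [measureReal_eq_integral hs.measurableSet, (isLocal_indicator hs).integral_eq]

/-- The sets that depend on finitely many sites. -/
def localSets (A : Type*) : Set (Set (ℤ → A)) := {s | ∃ L, IsLocal L fun x : ℤ → A => x ∈ s}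

theorem isPiSystem_localSets : IsPiSystem (localSets A) := by
  rintro s ⟨L, hs⟩ t ⟨L', ht⟩ -
  refine ⟨max L L', fun x y h => ?_⟩
  have h1 : (x ∈ s) = (y ∈ s) := hs x y fun j hj => h j (lt_max_of_lt_left hj)
  have h2 : (x ∈ t) = (y ∈ t) := ht x y fun j hj => h j (lt_max_of_lt_right hj)
  simp only [mem_inter_iff, h1, h2]

theorem generateFrom_localSets :
    (inferInstance : MeasurableSpace (ℤ → A)) = MeasurableSpace.generateFrom (localSets A) := by
  refine le_antisymm ?_ (MeasurableSpace.generateFrom_le ?_)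
  · refine iSup_le fun i => ?_
    rintro _ ⟨s, -, rfl⟩
    refine MeasurableSpace.measurableSet_generateFrom ⟨cell i + 1, fun x y h => ?_⟩
    have h1 : x i = y i := by
      have := h (cell i) (Nat.lt_succ_self _)
      rwa [site_cell] at this
    simp only [mem_preimage, h1]
  · rintro s ⟨L, hs⟩
    exact hs.measurableSet

/-- Local sets form a generating π-system, and each of their masses is a finite sum of masses of
cylinders. -/
theorem ext_of_cyl {μ ν : Measure (ℤ → A)} [IsProbabilityMeasure μ] [IsProbabilityMeasure ν]
    (h : ∀ m v, μ.real (cyl m v) = ν.real (cyl m v)) : μ = ν := by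
  classical
  refine ext_of_generate_finite _ generateFrom_localSets isPiSystem_localSets ?_ (by simp)
  rintro s ⟨L, hs⟩
  rw [← measureReal_eq_measureReal_iff, hs.measureReal_eq, hs.measureReal_eq]
  simp only [h]

/-! ### Compactness -/

/-- Every sequence of probability measures has a limit on cylinders along an ultrafilter. -/
theorem exists_limit_measure (U : Ultrafilter ℕ) (μ : ℕ → Measure (ℤ → A))
    [hμ : ∀ k, IsProbabilityMeasure (μ k)] :
    ∃ ν : Measure (ℤ → A), IsProbabilityMeasure ν ∧
      ∀ m v, Tendsto (fun k => (μ k).real (cyl m v)) U (𝓝 (ν.real (cyl m v))) := by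
  -- With the discrete topology on `A`, the space `ℤ → A` is compact and so is its space of
  -- probability measures.
  let _ : TopologicalSpace A := ⊥
  have : DiscreteTopology A := ⟨rfl⟩
  have : BorelSpace A := by
    constructor
    rw [borel_eq_top_of_discrete]
    exact MeasurableSpace.ext fun s => ⟨fun _ => trivial, fun _ => MeasurableSet.of_discrete⟩
  let P : ℕ → ProbabilityMeasure (ℤ → A) := fun k => ⟨μ k, hμ k⟩
  obtain ⟨ν, -, hν⟩ := isCompact_univ.ultrafilter_le_nhds (U.map P) (by simp)
  refine ⟨ν, inferInstance, fun m v => ?_⟩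
  have hT : Tendsto P U (𝓝 ν) := hν
  -- A clopen set has empty frontier, so weak convergence implies convergence of its mass.
  have hclopen : IsClopen (cyl m v : Set (ℤ → A)) := by
    have : (cyl m v : Set (ℤ → A))
        = ⋂ j ∈ Finset.range m, (fun x : ℤ → A => x (site j)) ⁻¹' {conf v (site j)} := by
      ext x
      simp [cyl]
    rw [this]
    exact isClopen_biInter_finset fun j _ =>
      (isClopen_discrete _).preimage (continuous_apply (site j))
  have h1 := ProbabilityMeasure.tendsto_measure_of_null_frontier_of_tendsto' hT
    (E := cyl m v) (by rw [hclopen.frontier_eq]; simp)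
  exact (ENNReal.tendsto_toReal (measure_ne_top _ _)).comp h1

/-- The common length `L` turns all integrals into finite sums over the same index set, so integrand
and measure may vary together. -/
theorem IsLocal.tendsto_integral {L : ℕ} {h : ℕ → (ℤ → A) → ℝ} {h' : (ℤ → A) → ℝ}
    (hh : ∀ k, IsLocal L (h k)) (hh' : IsLocal L h') {l : Filter ℕ} {μ : ℕ → Measure (ℤ → A)}
    [∀ k, IsProbabilityMeasure (μ k)] {ν : Measure (ℤ → A)} [IsProbabilityMeasure ν]
    (hμ : ∀ m v, Tendsto (fun k => (μ k).real (cyl m v)) l (𝓝 (ν.real (cyl m v))))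
    (hlim : ∀ x, Tendsto (fun k => h k x) l (𝓝 (h' x))) :
    Tendsto (fun k => ∫ x, h k x ∂μ k) l (𝓝 (∫ x, h' x ∂ν)) := by
  simp only [(hh _).integral_eq, hh'.integral_eq]
  exact tendsto_finsetSum _ fun v _ => (hμ L v).mul (hlim _)

theorem IsLocal.tendsto_measureReal {L : ℕ} {s : Set (ℤ → A)} (hs : IsLocal L fun x => x ∈ s)
    {l : Filter ℕ} {μ : ℕ → Measure (ℤ → A)}
    [∀ k, IsProbabilityMeasure (μ k)] {ν : Measure (ℤ → A)} [IsProbabilityMeasure ν]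
    (hμ : ∀ m v, Tendsto (fun k => (μ k).real (cyl m v)) l (𝓝 (ν.real (cyl m v)))) :
    Tendsto (fun k => (μ k).real s) l (𝓝 (ν.real s)) := by
  classical
  simp only [hs.measureReal_eq]
  exact tendsto_finsetSum _ fun v _ => (hμ L v).mul tendsto_const_nhds

end Coding
-- The Markov operator of a probabilistic cellular automaton and its invariant measures
section Kernel

variable {A : Type*} [Fintype A] [Nonempty A] {N : Finset ℤ}

/-- The largest absolute value of an element of `N`. -/
def radius (N : Finset ℤ) : ℕ := N.sup Int.natAbs

/-- The probability that the first `m` new letters are those of `conf v`. -/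
noncomputable def blk (φ : (N → A) → A → ℝ) (m v : ℕ) (x : ℤ → A) : ℝ :=
  ∏ j ∈ Finset.range m, φ (patternAt N x (site j)) (conf v (site j))

/-- The first m sites only read neighbours at displacement at most `radius N`, and
`cell_site_add_lt` bounds their numbers. The length does not depend on φ, which matters when the
rule varies in a limit. -/
theorem isLocal_blk (φ : (N → A) → A → ℝ) (m v : ℕ) :
    IsLocal (m + 2 * radius N + 2) (blk φ m v) := by
  intro x y h
  refine Finset.prod_congr rfl fun j hj => ?_
  congr 1
  funext t
  have h1 := cell_site_add_lt j (t : ℤ)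
  have h2 : (t : ℤ).natAbs ≤ radius N := Finset.le_sup (f := Int.natAbs) t.2
  have h3 := h (cell (site j + t)) (by have := Finset.mem_range.1 hj; omega)
  rwa [site_cell] at h3

theorem isLocal_shift (m v : ℕ) : IsLocal (m + 4) fun x : ℤ → A => x ∈ shift ⁻¹' cyl m v := by
  intro x y h
  refine isLocal_cyl m v _ _ fun j hj => ?_
  have h1 := cell_site_add_lt j 1
  have h3 := h (cell (site j + 1)) (by simp at h1; omega)
  rwa [site_cell] at h3

variable [MeasurableSpace A] [DiscreteMeasurableSpace A]

namespace StochasticRule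

/-- The entries of the matrix as real numbers. -/
def realProb (φ : StochasticRule A N) (u : N → A) (a : A) : ℝ := φ.prob u a

theorem siteLaw_singleton [MeasurableSingletonClass A] (φ : StochasticRule A N) (u : N → A) (a : A) :
    φ.siteLaw u {a} = ENNReal.ofReal (φ.realProb u a) := by
  classical
  simp only [siteLaw, Measure.finsetSum_apply, Measure.smul_apply, smul_eq_mul]
  rw [Finset.sum_eq_single a]
  · simp [realProb]
  · intro b _ hb
    simp [hb]
  · simp

theorem realProb_nonneg (φ : StochasticRule A N) (u : N → A) (a : A) : 0 ≤ φ.realProb u a :=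
  (φ.prob u a).2.1

theorem realProb_le_one (φ : StochasticRule A N) (u : N → A) (a : A) : φ.realProb u a ≤ 1 :=
  (φ.prob u a).2.2

instance (φ : StochasticRule A N) (x : ℤ → A) : IsProbabilityMeasure (φ.transition x) := by
  unfold transition
  infer_instance

theorem transition_cyl (φ : StochasticRule A N) (x : ℤ → A) (m v : ℕ) :
    (φ.transition x).real (cyl m v) = blk φ.realProb m v x := by
  have h : (cyl m v : Set (ℤ → A))
      = Set.pi ((Finset.range m).image site : Finset ℤ) fun i => {conf v i} := by
    ext y
    simp [cyl, Set.pi]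
  have h1 : φ.transition x (cyl m v) = ENNReal.ofReal (blk φ.realProb m v x) := by
    rw [h, transition, Measure.infinitePi_pi _ fun i _ => MeasurableSet.of_discrete,
      Finset.prod_image fun a _ b _ hab => site_injective hab, blk,
      ENNReal.ofReal_prod_of_nonneg fun j _ => φ.realProb_nonneg _ _]
    exact Finset.prod_congr rfl fun j _ => φ.siteLaw_singleton _ _
  rw [Measure.real, h1, ENNReal.toReal_ofReal]
  exact Finset.prod_nonneg fun j _ => φ.realProb_nonneg _ _

/-- It suffices to treat local sets, whose transition probabilities are finite combinations of the
local functions `blk`. -/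
theorem measurable_transition (φ : StochasticRule A N) : Measurable φ.transition := by
  classical
  refine Measurable.measure_of_isPiSystem_of_isProbabilityMeasure generateFrom_localSets
    isPiSystem_localSets ?_
  rintro s ⟨L, hs⟩
  have h1 : (fun x => φ.transition x s) = fun x => ENNReal.ofReal
      (∑ v ∈ Finset.range (Fintype.card A ^ L),
        blk φ.realProb L v x * if (conf v : ℤ → A) ∈ s then 1 else 0) := by
    funext x
    rw [← ofReal_measureReal (μ := φ.transition x) (s := s), hs.measureReal_eq]
    simp only [transition_cyl]
  rw [h1]
  exact (Finset.measurable_sum _ fun v _ =>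
    ((isLocal_blk _ _ _).measurable.mul_const _)).ennreal_ofReal

theorem bind_apply (φ : StochasticRule A N) (μ : Measure (ℤ → A)) {s : Set (ℤ → A)}
    (hs : MeasurableSet s) : μ.bind φ.transition s = ∫⁻ x, φ.transition x s ∂μ :=
  Measure.bind_apply hs φ.measurable_transition.aemeasurable

instance (φ : StochasticRule A N) (μ : Measure (ℤ → A)) [IsProbabilityMeasure μ] :
    IsProbabilityMeasure (μ.bind φ.transition) := by
  constructor
  rw [φ.bind_apply μ MeasurableSet.univ]
  simp

theorem bind_real_cyl (φ : StochasticRule A N) (μ : Measure (ℤ → A)) [IsProbabilityMeasure μ]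
    (m v : ℕ) : (μ.bind φ.transition).real (cyl m v) = ∫ x, blk φ.realProb m v x ∂μ := by
  have h0 : ∀ x, 0 ≤ blk φ.realProb m v x := fun x =>
    Finset.prod_nonneg fun j _ => φ.realProb_nonneg _ _
  rw [integral_eq_lintegral_of_nonneg_ae (ae_of_all _ h0)
    (isLocal_blk _ _ _).measurable.aestronglyMeasurable, Measure.real,
    φ.bind_apply μ (measurableSet_cyl m v)]
  congr 1
  refine lintegral_congr fun x => ?_
  rw [← φ.transition_cyl, ofReal_measureReal]

theorem bind_eq_self_iff (φ : StochasticRule A N) (μ : Measure (ℤ → A)) [IsProbabilityMeasure μ] :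
    μ.bind φ.transition = μ ↔ ∀ m v, ∫ x, blk φ.realProb m v x ∂μ = μ.real (cyl m v) := by
  constructor
  · intro h m v
    rw [← φ.bind_real_cyl, h]
  · intro h
    exact ext_of_cyl fun m v => by rw [φ.bind_real_cyl, h]

/-- Countably many equations on integrals of local functions: in this form invariance passes to
limits and can be tested approximately. -/
theorem mem_invariantMeasures_iff (φ : StochasticRule A N) (μ : ShiftMeasure A) :
    μ ∈ φ.invariantMeasures ↔
      ∀ m v, ∫ x, blk φ.realProb m v x ∂μ.toMeasure = μ.toMeasure.real (cyl m v) := by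
  rw [← φ.bind_eq_self_iff]
  constructor
  · intro h
    ext s hs
    rw [φ.bind_apply _ hs, h s hs]
  · intro h s hs
    rw [← φ.bind_apply _ hs, h]

/-- The product measure is determined by its values on boxes, and the site i+1 reads in x the
pattern that the site i reads in the shifted configuration. -/
theorem transition_shift (φ : StochasticRule A N) (x : ℤ → A) :
    (φ.transition x).map shift = φ.transition (shift x) := by
  refine Measure.eq_infinitePi _ fun s t ht => ?_
  have hm : MeasurableSet (Set.pi (s : Set ℤ) t) :=
    MeasurableSet.pi s.countable_toSet fun i _ => ht i
  rw [Measure.map_apply measurable_shift hm]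
  have h1 : (shift ⁻¹' Set.pi (s : Set ℤ) t : Set (ℤ → A))
      = Set.pi ((s.image fun i => i + 1 : Finset ℤ) : Set ℤ) fun i => t (i - 1) := by
    ext y
    simp only [shift, Set.pi, mem_preimage, mem_ofPred_eq, Finset.coe_image, Set.forall_mem_image,
      Finset.mem_coe, add_sub_cancel_right]
  rw [h1, transition, Measure.infinitePi_pi _ fun i _ => ht _,
    Finset.prod_image fun a _ b _ hab => by simpa using hab]
  refine Finset.prod_congr rfl fun i _ => ?_
  have h2 : patternAt N x (i + 1) = patternAt N (shift x) i := by
    funext j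
    simp only [patternAt, shift]
    congr 1
    ring
  simp [h2]

end StochasticRule

/-- A probability measure whose cylinders are shift-invariant. -/
noncomputable def ShiftMeasure.ofCyl (μ : Measure (ℤ → A)) [hμ : IsProbabilityMeasure μ]
    (h : ∀ m v, μ.real (shift ⁻¹' cyl m v) = μ.real (cyl m v)) : ShiftMeasure A where
  toMeasure := μ
  isProb := hμ
  shift_inv s hs := by
    have : IsProbabilityMeasure (μ.map shift) :=
      Measure.isProbabilityMeasure_map measurable_shift.aemeasurable
    have h1 : μ.map shift = μ := ext_of_cyl fun m v => by
      rw [map_measureReal_apply measurable_shift (measurableSet_cyl m v), h]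
    rw [← Measure.map_apply measurable_shift hs, h1]

theorem ShiftMeasure.map_shift (μ : ShiftMeasure A) : μ.toMeasure.map shift = μ.toMeasure := by
  ext s hs
  rw [Measure.map_apply measurable_shift hs, μ.shift_inv s hs]

theorem ShiftMeasure.real_shift_cyl (μ : ShiftMeasure A) (m v : ℕ) :
    μ.toMeasure.real (shift ⁻¹' cyl m v) = μ.toMeasure.real (cyl m v) := by
  rw [Measure.real, μ.shift_inv _ (measurableSet_cyl m v), Measure.real]

/-- The image of a shift-invariant measure under a probabilistic cellular automaton. -/
noncomputable def StochasticRule.image (φ : StochasticRule A N) (μ : ShiftMeasure A) :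
    ShiftMeasure A where
  toMeasure := μ.toMeasure.bind φ.transition
  isProb := inferInstance
  shift_inv s hs := by
    have hm : Measurable fun x => φ.transition x s := (Measure.measurable_coe hs).comp
      φ.measurable_transition
    rw [φ.bind_apply _ (measurable_shift hs), φ.bind_apply _ hs]
    conv_rhs => rw [← μ.map_shift, lintegral_map hm measurable_shift]
    refine lintegral_congr fun x => ?_
    rw [← φ.transition_shift, Measure.map_apply measurable_shift hs]

/-- Limits of measures that are asymptotically invariant under converging rules are invariant. -/
theorem exists_invariant_of_tendsto (U : Ultrafilter ℕ) (μ : ℕ → Measure (ℤ → A))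
    [∀ k, IsProbabilityMeasure (μ k)] (ψ : ℕ → (N → A) → A → ℝ) (φ : StochasticRule A N)
    (hψ : ∀ u a, Tendsto (fun k => ψ k u a) U (𝓝 (φ.realProb u a)))
    (hs : ∀ m v, Tendsto
      (fun k => (μ k).real (shift ⁻¹' cyl m v) - (μ k).real (cyl m v)) U (𝓝 0))
    (hi : ∀ m v, Tendsto
      (fun k => ∫ x, blk (ψ k) m v x ∂μ k - (μ k).real (cyl m v)) U (𝓝 0)) :
    ∃ ν ∈ φ.invariantMeasures,
      ∀ m v, Tendsto (fun k => (μ k).real (cyl m v)) U (𝓝 (ν.toMeasure.real (cyl m v))) := by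
  obtain ⟨ν, hν, hlim⟩ := exists_limit_measure U μ
  have h1 : ∀ m v, ν.real (shift ⁻¹' cyl m v) = ν.real (cyl m v) := fun m v =>
    sub_eq_zero.1 (tendsto_nhds_unique
      (((isLocal_shift m v).tendsto_measureReal hlim).sub (hlim m v)) (hs m v))
  refine ⟨ShiftMeasure.ofCyl ν h1, (φ.mem_invariantMeasures_iff _).2 fun m v => ?_, hlim⟩
  refine sub_eq_zero.1 (tendsto_nhds_unique (Tendsto.sub ?_ (hlim m v)) (hi m v))
  exact IsLocal.tendsto_integral (fun k => isLocal_blk (ψ k) m v) (isLocal_blk _ m v) hlim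
    fun x => tendsto_finsetProd _ fun j _ => hψ _ _

/-- The case of zero defects in `exists_invariant_of_tendsto`; it expresses that the graph of the
map from rules to invariant measures is closed. -/
theorem exists_invariant_of_tendsto_rule (U : Ultrafilter ℕ) (μ : ℕ → ShiftMeasure A)
    (φ' : ℕ → StochasticRule A N) (φ : StochasticRule A N)
    (hφ : ∀ u a, Tendsto (fun k => (φ' k).realProb u a) U (𝓝 (φ.realProb u a)))
    (hμ : ∀ k, μ k ∈ (φ' k).invariantMeasures) :
    ∃ ν ∈ φ.invariantMeasures, ∀ m v, Tendsto (fun k => (μ k).toMeasure.real (cyl m v)) U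
      (𝓝 (ν.toMeasure.real (cyl m v))) := by
  refine exists_invariant_of_tendsto U (fun k => (μ k).toMeasure) (fun k => (φ' k).realProb) φ hφ
    (fun m v => ?_) fun m v => ?_
  · simp only [ShiftMeasure.real_shift_cyl, sub_self]
    exact tendsto_const_nhds
  · simp only [((φ' _).mem_invariantMeasures_iff _).1 (hμ _), sub_self]
    exact tendsto_const_nhds

/-- The average of the first `n + 1` terms of a sequence of measures. -/
noncomputable def average (μ : ℕ → ShiftMeasure A) (n : ℕ) : Measure (ℤ → A) :=
  ((n + 1 : ℕ) : ENNReal)⁻¹ • ∑ k ∈ Finset.range (n + 1), (μ k).toMeasure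

instance (μ : ℕ → ShiftMeasure A) (n : ℕ) : IsProbabilityMeasure (average μ n) := by
  constructor
  simp only [average, Measure.smul_apply, Measure.finsetSum_apply, measure_univ,
    Finset.sum_const, Finset.card_range, nsmul_eq_mul, mul_one, smul_eq_mul]
  exact ENNReal.inv_mul_cancel (by simp) (ENNReal.natCast_ne_top _)

theorem average_real (μ : ℕ → ShiftMeasure A) (n : ℕ) (s : Set (ℤ → A)) :
    (average μ n).real s
      = ((n : ℝ) + 1)⁻¹ * ∑ k ∈ Finset.range (n + 1), (μ k).toMeasure.real s := by
  simp only [average, Measure.real, Measure.smul_apply, Measure.finsetSum_apply, smul_eq_mul,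
    ENNReal.toReal_mul, ENNReal.toReal_inv, ENNReal.toReal_natCast]
  rw [ENNReal.toReal_sum fun k _ => measure_ne_top _ _]
  push_cast
  rfl

theorem IsLocal.integral_average {L : ℕ} {h : (ℤ → A) → ℝ} (hh : IsLocal L h)
    (μ : ℕ → ShiftMeasure A) (n : ℕ) : ∫ x, h x ∂average μ n
      = ((n : ℝ) + 1)⁻¹ * ∑ k ∈ Finset.range (n + 1), ∫ x, h x ∂(μ k).toMeasure := by
  simp only [hh.integral_eq, average_real, Finset.mul_sum, Finset.sum_mul]
  rw [Finset.sum_comm]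
  simp only [mul_assoc]

/-- The Krylov–Bogoliubov theorem for probabilistic cellular automata. -/
theorem StochasticRule.invariantMeasures_nonempty (φ : StochasticRule A N) :
    φ.invariantMeasures.Nonempty := by
  let a : A := Classical.arbitrary A
  -- The starting point is immaterial; the word of length one gives a Dirac mass at a constant
  -- configuration.
  let μ : ℕ → ShiftMeasure A := fun k => φ.image^[k] (periodicMeasure (a, []))
  have hμ : ∀ k, (μ (k + 1)).toMeasure = (μ k).toMeasure.bind φ.transition := fun k => by
    simp only [μ, Function.iterate_succ_apply']
    rfl
  suffices h : ∀ m v, Tendsto (fun n => ∫ x, blk φ.realProb m v x ∂average μ n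
      - (average μ n).real (cyl m v)) (hyperfilter ℕ) (𝓝 0) by
    obtain ⟨ν, hν, -⟩ := exists_invariant_of_tendsto (hyperfilter ℕ) (average μ)
      (fun _ => φ.realProb) φ (fun u a => tendsto_const_nhds) (fun m v => by
        simp only [average_real, ShiftMeasure.real_shift_cyl, sub_self]
        exact tendsto_const_nhds) h
    exact ⟨ν, hν⟩
  intro m v
  -- Applying the rule shifts the index in the average by one, so the defect telescopes and is at
  -- most 1/(n+1).
  have h1 : ∀ n : ℕ, ∫ x, blk φ.realProb m v x ∂average μ n - (average μ n).real (cyl m v)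
      = ((n : ℝ) + 1)⁻¹ *
        ((μ (n + 1)).toMeasure.real (cyl m v) - (μ 0).toMeasure.real (cyl m v)) := by
    intro n
    rw [(isLocal_blk _ m v).integral_average, average_real, ← mul_sub]
    congr 1
    simp only [← φ.bind_real_cyl, ← hμ]
    rw [← Finset.sum_sub_distrib,
      Finset.sum_range_sub fun k => (μ k).toMeasure.real (cyl m v)]
  simp only [h1]
  refine Tendsto.mono_left ?_ Nat.hyperfilter_le_atTop
  refine squeeze_zero_norm (a := fun n : ℕ => 1 / ((n : ℝ) + 1)) (fun n => ?_)
    tendsto_one_div_add_atTop_nhds_zero_nat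
  rw [norm_mul, norm_inv, one_div, Real.norm_of_nonneg (by positivity : (0 : ℝ) ≤ (n : ℝ) + 1)]
  refine mul_le_of_le_one_right (by positivity) ?_
  rw [Real.norm_eq_abs, abs_le]
  have h2 : ∀ k, 0 ≤ (μ k).toMeasure.real (cyl m v) := fun k => measureReal_nonneg
  have h3 : ∀ k, (μ k).toMeasure.real (cyl m v) ≤ 1 := fun k => measureReal_le_one
  constructor <;> linarith [h2 0, h3 0, h2 (n + 1), h3 (n + 1)]

end Kernel
/-! ### The distance between probability measures -/

section Distance

variable {A : Type*} [Fintype A] [Nonempty A] [MeasurableSpace A]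

/-- The total variation distance on the window `⟦-n, n⟧`. -/
noncomputable def cylDist (n : ℕ) (μ ν : Measure (ℤ → A)) : ℝ :=
  (1 / 2 : ℝ) * ∑ v ∈ Finset.range (Fintype.card A ^ (2 * n + 1)),
    |μ.real (cyl (2 * n + 1) v) - ν.real (cyl (2 * n + 1) v)|

/-- The partial sums of the series that defines the distance of two measures. -/
noncomputable def partialDist (k : ℕ) (μ ν : Measure (ℤ → A)) : ℝ :=
  ∑ n ∈ Finset.range k, (1 / 2 : ℝ) ^ n * cylDist n μ ν

/-- The distance of two measures, which need not be shift-invariant. -/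
noncomputable def measureDist (μ ν : Measure (ℤ → A)) : ℝ :=
  ∑' n : ℕ, (1 / 2 : ℝ) ^ n * cylDist n μ ν

theorem cylDist_nonneg (n : ℕ) (μ ν : Measure (ℤ → A)) : 0 ≤ cylDist n μ ν :=
  mul_nonneg (by norm_num) (Finset.sum_nonneg fun _ _ => abs_nonneg _)

theorem cylDist_comm (n : ℕ) (μ ν : Measure (ℤ → A)) : cylDist n μ ν = cylDist n ν μ := by
  simp only [cylDist, abs_sub_comm]

theorem cylDist_triangle (n : ℕ) (μ ν ρ : Measure (ℤ → A)) :
    cylDist n μ ρ ≤ cylDist n μ ν + cylDist n ν ρ := by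
  unfold cylDist
  rw [← mul_add, ← Finset.sum_add_distrib]
  gcongr
  exact abs_sub_le _ _ _

variable [DiscreteMeasurableSpace A]

theorem sum_real_cyl (m : ℕ) (μ : Measure (ℤ → A)) [IsProbabilityMeasure μ] :
    ∑ v ∈ Finset.range (Fintype.card A ^ m), μ.real (cyl m v) = 1 := by
  have h : IsLocal m fun _ : ℤ → A => (1 : ℝ) := fun _ _ _ => rfl
  have h1 := h.integral_eq μ
  simpa using h1.symm

theorem cylDist_le_one (n : ℕ) (μ ν : Measure (ℤ → A)) [IsProbabilityMeasure μ]
    [IsProbabilityMeasure ν] : cylDist n μ ν ≤ 1 := by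
  have h : ∑ v ∈ Finset.range (Fintype.card A ^ (2 * n + 1)),
      |μ.real (cyl (2 * n + 1) v) - ν.real (cyl (2 * n + 1) v)|
      ≤ ∑ v ∈ Finset.range (Fintype.card A ^ (2 * n + 1)),
        (μ.real (cyl (2 * n + 1) v) + ν.real (cyl (2 * n + 1) v)) := by
    refine Finset.sum_le_sum fun u _ => ?_
    have h1 : 0 ≤ μ.real (cyl (2 * n + 1) u) := measureReal_nonneg
    have h2 : 0 ≤ ν.real (cyl (2 * n + 1) u) := measureReal_nonneg
    rw [abs_le]
    constructor <;> linarith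
  rw [Finset.sum_add_distrib, sum_real_cyl, sum_real_cyl] at h
  unfold cylDist
  linarith

theorem summable_cylDist (μ ν : Measure (ℤ → A)) [IsProbabilityMeasure μ]
    [IsProbabilityMeasure ν] : Summable fun n : ℕ => (1 / 2 : ℝ) ^ n * cylDist n μ ν := by
  refine Summable.of_nonneg_of_le (fun n => mul_nonneg (by positivity) (cylDist_nonneg _ _ _))
    (fun n => ?_) summable_geometric_two
  exact mul_le_of_le_one_right (by positivity) (cylDist_le_one _ _ _)

theorem measureDist_triangle (μ ν ρ : Measure (ℤ → A)) [IsProbabilityMeasure μ]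
    [IsProbabilityMeasure ν] [IsProbabilityMeasure ρ] :
    measureDist μ ρ ≤ measureDist μ ν + measureDist ν ρ := by
  unfold measureDist
  rw [← (summable_cylDist μ ν).tsum_add (summable_cylDist ν ρ)]
  refine (summable_cylDist μ ρ).tsum_le_tsum (fun n => ?_)
    ((summable_cylDist μ ν).add (summable_cylDist ν ρ))
  rw [← mul_add]
  exact mul_le_mul_of_nonneg_left (cylDist_triangle _ _ _ _) (by positivity)

theorem measureDist_comm (μ ν : Measure (ℤ → A)) : measureDist μ ν = measureDist ν μ := by
  simp only [measureDist, cylDist_comm]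

theorem partialDist_triangle (k : ℕ) (μ ν ρ : Measure (ℤ → A)) :
    partialDist k μ ρ ≤ partialDist k μ ν + partialDist k ν ρ := by
  unfold partialDist
  rw [← Finset.sum_add_distrib]
  refine Finset.sum_le_sum fun n _ => ?_
  rw [← mul_add]
  exact mul_le_mul_of_nonneg_left (cylDist_triangle _ _ _ _) (by positivity)

theorem partialDist_mono (μ ν : Measure (ℤ → A)) : Monotone fun k => partialDist k μ ν :=
  fun _ _ h => Finset.sum_le_sum_of_subset_of_nonneg (Finset.range_mono h)
    fun _ _ _ => mul_nonneg (by positivity) (cylDist_nonneg _ _ _)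

/-- The terms are nonnegative, so a non-strict upper bound on the distance is a universal statement
about partial sums, hence Π₁ for computable families. -/
theorem measureDist_le_iff (μ ν : Measure (ℤ → A)) [IsProbabilityMeasure μ]
    [IsProbabilityMeasure ν] (r : ℝ) : measureDist μ ν ≤ r ↔ ∀ k, partialDist k μ ν ≤ r := by
  have h : ∀ n, 0 ≤ (1 / 2 : ℝ) ^ n * cylDist n μ ν := fun n =>
    mul_nonneg (by positivity) (cylDist_nonneg _ _ _)
  exact ⟨fun hr k => ((summable_cylDist μ ν).sum_le_tsum _ fun n _ => h n).trans hr,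
    fun hr => Real.tsum_le_of_sum_range_le h hr⟩

theorem measureDist_le_partialDist (k : ℕ) (μ ν : Measure (ℤ → A)) [IsProbabilityMeasure μ]
    [IsProbabilityMeasure ν] : measureDist μ ν ≤ partialDist k μ ν + 2 * (1 / 2 : ℝ) ^ k := by
  unfold measureDist
  rw [← (summable_cylDist μ ν).sum_add_tsum_nat_add k]
  refine add_le_add_right ?_ _
  have h1 : ∀ n : ℕ, (1 / 2 : ℝ) ^ (n + k) * cylDist (n + k) μ ν
      ≤ (1 / 2 : ℝ) ^ k * (1 / 2 : ℝ) ^ n := fun n => by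
    rw [← pow_add, add_comm k n]
    exact mul_le_of_le_one_right (by positivity) (cylDist_le_one _ _ _)
  calc _ ≤ ∑' n : ℕ, (1 / 2 : ℝ) ^ k * (1 / 2 : ℝ) ^ n :=
        ((summable_nat_add_iff k).2 (summable_cylDist μ ν)).tsum_le_tsum h1
          (summable_geometric_two.mul_left _)
    _ = _ := by rw [tsum_mul_left, tsum_geometric_two, mul_comm]

theorem tendsto_partialDist {l : Filter ℕ} {μ : ℕ → Measure (ℤ → A)} {ν : Measure (ℤ → A)}
    (hμ : ∀ m v, Tendsto (fun k => (μ k).real (cyl m v)) l (𝓝 (ν.real (cyl m v))))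
    (K : ℕ) (q : Measure (ℤ → A)) :
    Tendsto (fun k => partialDist K (μ k) q) l (𝓝 (partialDist K ν q)) :=
  tendsto_finsetSum _ fun _ _ => ((tendsto_finsetSum _ fun v _ =>
    ((hμ _ v).sub tendsto_const_nhds).abs).const_mul _).const_mul _

/-- A diagonal argument: by monotonicity, the bound at level k controls every fixed truncation K ≤
k, and a fixed truncation passes to the limit. -/
theorem measureDist_le_of_tendsto {l : Filter ℕ} [l.NeBot] (hl : l ≤ atTop)
    {μ : ℕ → Measure (ℤ → A)} {ν q : Measure (ℤ → A)} [IsProbabilityMeasure ν]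
    [IsProbabilityMeasure q]
    (hμ : ∀ m v, Tendsto (fun k => (μ k).real (cyl m v)) l (𝓝 (ν.real (cyl m v))))
    {r : ℕ → ℝ} {r' : ℝ} (hr : Tendsto r l (𝓝 r')) (h : ∀ k, partialDist k (μ k) q ≤ r k) :
    measureDist ν q ≤ r' := by
  refine (measureDist_le_iff _ _ _).2 fun K => ?_
  refine le_of_tendsto_of_tendsto (tendsto_partialDist hμ K q) hr ?_
  filter_upwards [hl (eventually_ge_atTop K)] with k hk
  exact (partialDist_mono _ _ hk).trans (h k)

/-- The geometric series dominates, so convergence on cylinders implies convergence in the metric.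
-/
theorem tendsto_measureDist {l : Filter ℕ} {μ : ℕ → Measure (ℤ → A)} {ν : Measure (ℤ → A)}
    [∀ k, IsProbabilityMeasure (μ k)] [IsProbabilityMeasure ν]
    (hμ : ∀ m v, Tendsto (fun k => (μ k).real (cyl m v)) l (𝓝 (ν.real (cyl m v)))) :
    Tendsto (fun k => measureDist (μ k) ν) l (𝓝 0) := by
  have h1 : Tendsto (fun k => measureDist (μ k) ν) l
      (𝓝 (∑' n : ℕ, (1 / 2 : ℝ) ^ n * cylDist n ν ν)) := by
    refine tendsto_tsum_of_dominated_convergence summable_geometric_two (fun n => ?_) ?_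
    · exact (((tendsto_finsetSum _ fun v _ =>
        ((hμ _ v).sub tendsto_const_nhds).abs).const_mul _).const_mul _)
    · refine Eventually.of_forall fun k n => ?_
      rw [Real.norm_of_nonneg (mul_nonneg (by positivity) (cylDist_nonneg _ _ _))]
      exact mul_le_of_le_one_right (by positivity) (cylDist_le_one _ _ _)
  simpa [cylDist] using h1

theorem cylinderOn_window (n v : ℕ) :
    cylinderOn (window n) (fun i : window n => (conf v : ℤ → A) i) = cyl (2 * n + 1) v := by
  ext x
  constructor
  · intro h j hj
    exact h ⟨site j, (mem_window_iff n _).2 (by rwa [cell_site])⟩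
  · rintro h ⟨i, hi⟩
    have := h (cell i) ((mem_window_iff n i).1 hi)
    rwa [site_cell] at this

theorem tvDist_window (n : ℕ) (μ ν : ShiftMeasure A) :
    tvDist (window n) μ ν = cylDist n μ.toMeasure ν.toMeasure := by
  unfold tvDist cylDist
  congr 1
  symm
  refine Finset.sum_bij (fun v _ => fun i : window n => (conf v : ℤ → A) i)
    (fun v _ => Finset.mem_univ _) (fun v hv w hw h => ?_) (fun u _ => ?_) fun v _ => ?_
  · refine eq_of_mem_cyl (Finset.mem_range.1 hv) (Finset.mem_range.1 hw)
      (conf_mem_cyl (A := A) _ v) ?_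
    rw [← cylinderOn_window, ← h, cylinderOn_window]
    exact conf_mem_cyl _ _
  · let x : ℤ → A := fun i => if h : i ∈ window n then u ⟨i, h⟩ else Classical.arbitrary A
    obtain ⟨v, hv, hx⟩ := exists_mem_cyl (2 * n + 1) x
    refine ⟨v, Finset.mem_range.2 hv, funext fun i => ?_⟩
    rw [← cylinderOn_window] at hx
    exact (hx i).symm.trans (by simp [x])
  · simp only [cylinderOn_window]

theorem dist_eq_measureDist (μ ν : ShiftMeasure A) :
    dist μ ν = measureDist μ.toMeasure ν.toMeasure := by
  change distM μ ν = _
  simp only [distM, measureDist, tvDist_window]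

/-! ### Finitely supported measures -/

/-- The unnormalized weights of the measure with code `x`. -/
def weight (G x s : ℕ) : ℕ := x / (G + 1) ^ s % (G + 1) + 1

/-- The sum of the unnormalized weights. -/
def totalWeight (K G x : ℕ) : ℕ := ∑ s ∈ Finset.range K, weight G x s

theorem totalWeight_pos {K : ℕ} (hK : 0 < K) (G x : ℕ) : 0 < totalWeight K G x :=
  Finset.sum_pos (fun _ _ => Nat.succ_pos _) ⟨0, Finset.mem_range.2 hK⟩

/-- The measure with code `x` supported by the configurations coded by words of length `L`. -/
noncomputable def atomic (A : Type*) [Fintype A] [Nonempty A] [MeasurableSpace A] (L G x : ℕ) :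
    Measure (ℤ → A) :=
  (totalWeight (Fintype.card A ^ L) G x : ENNReal)⁻¹ •
    ∑ s ∈ Finset.range (Fintype.card A ^ L), (weight G x s : ENNReal) • Measure.dirac (conf s)

theorem totalWeight_card_pos (A : Type*) [Fintype A] [Nonempty A] (L G x : ℕ) :
    0 < totalWeight (Fintype.card A ^ L) G x := totalWeight_pos (pow_pos Fintype.card_pos _) _ _

instance (L G x : ℕ) : IsProbabilityMeasure (atomic A L G x) := by
  constructor
  simp only [atomic, Measure.smul_apply, Measure.finsetSum_apply, measure_univ, smul_eq_mul,
    mul_one]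
  rw [← Nat.cast_sum]
  exact ENNReal.inv_mul_cancel (by exact_mod_cast (totalWeight_card_pos A L G x).ne')
    (ENNReal.natCast_ne_top _)

theorem IsLocal.integral_atomic {M : ℕ} {h : (ℤ → A) → ℝ} (hh : IsLocal M h) (L G x : ℕ) :
    ∫ y, h y ∂atomic A L G x = (totalWeight (Fintype.card A ^ L) G x : ℝ)⁻¹ *
      ∑ s ∈ Finset.range (Fintype.card A ^ L), (weight G x s : ℝ) * h (conf s) := by
  rw [atomic, integral_smul_measure, integral_finsetSum_measure]
  · simp only [integral_smul_measure, ENNReal.toReal_inv, ENNReal.toReal_natCast, smul_eq_mul]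
    simp only [integral_dirac' _ _ hh.measurable.stronglyMeasurable]
  · intro s _
    exact (hh.integrable _).smul_measure (ENNReal.natCast_ne_top _)

open Classical in
theorem IsLocal.atomic_real {M : ℕ} {S : Set (ℤ → A)} (hS : IsLocal M fun y => y ∈ S)
    (L G x : ℕ) : (atomic A L G x).real S = (totalWeight (Fintype.card A ^ L) G x : ℝ)⁻¹ *
      ∑ s ∈ Finset.range (Fintype.card A ^ L),
        (weight G x s : ℝ) * if (conf s : ℤ → A) ∈ S then 1 else 0 := by
  rw [measureReal_eq_integral hS.measurableSet, (isLocal_indicator hS).integral_atomic]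

theorem atomic_real_cyl (L G x : ℕ) {s : ℕ} (hs : s < Fintype.card A ^ L) :
    (atomic A L G x).real (cyl L s) =
      (weight G x s : ℝ) / totalWeight (Fintype.card A ^ L) G x := by
  classical
  rw [(isLocal_cyl L s).atomic_real, Finset.sum_eq_single s]
  · simp [conf_mem_cyl, div_eq_inv_mul]
  · intro t ht hne
    rw [if_neg, mul_zero]
    exact fun h => hne (eq_of_mem_cyl (Finset.mem_range.1 ht) hs (conf_mem_cyl L t) h)
  · exact fun h => absurd (Finset.mem_range.2 hs) h

/-- The `ℓ¹` distance of two measures on the first `L` sites. -/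
noncomputable def ellDist (L : ℕ) (μ ν : Measure (ℤ → A)) : ℝ :=
  ∑ s ∈ Finset.range (Fintype.card A ^ L), |μ.real (cyl L s) - ν.real (cyl L s)|

theorem exists_atomic (ν : Measure (ℤ → A)) [IsProbabilityMeasure ν] (L : ℕ) {G : ℕ} (hG : 0 < G) :
    ∃ x < (G + 1) ^ (Fintype.card A ^ L),
      ellDist L (atomic A L G x) ν ≤ 2 * (Fintype.card A ^ L : ℕ) / G := by
  set K := Fintype.card A ^ L with hK
  have hK0 : 0 < K := pow_pos Fintype.card_pos _
  have hG0 : (0 : ℝ) < G := by exact_mod_cast hG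
  have hp0 : ∀ s, 0 ≤ ν.real (cyl L s) := fun s => measureReal_nonneg
  have hp1 : ∀ s, ν.real (cyl L s) ≤ 1 := fun s => measureReal_le_one
  -- The digits are floors and `weight` adds 1, so each weight exceeds its target by at most 1 and
  -- the total lies between G and G + K.
  obtain ⟨x, hx, hd⟩ := exists_digits (c := G + 1) K (fun s => ⌊G * ν.real (cyl L s)⌋₊)
    fun s => Nat.lt_succ_of_le (Nat.floor_le_of_le (mul_le_of_le_one_right hG0.le (hp1 s)))
  refine ⟨x, hx, ?_⟩
  have hw : ∀ s < K, G * ν.real (cyl L s) ≤ weight G x s ∧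
      (weight G x s : ℝ) ≤ G * ν.real (cyl L s) + 1 := by
    intro s hs
    simp only [weight, hd s hs]
    push_cast
    exact ⟨(Nat.lt_floor_add_one _).le,
      add_le_add_left (Nat.floor_le (mul_nonneg hG0.le (hp0 s))) 1⟩
  have hT : (G : ℝ) ≤ totalWeight K G x ∧ (totalWeight K G x : ℝ) ≤ G + K := by
    have h1 : ∑ s ∈ Finset.range K, G * ν.real (cyl L s) = G := by
      rw [← Finset.mul_sum, hK, sum_real_cyl, mul_one]
    unfold totalWeight
    push_cast
    constructor
    · calc (G : ℝ) = _ := h1.symm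
        _ ≤ _ := Finset.sum_le_sum fun s hs => (hw s (Finset.mem_range.1 hs)).1
    · calc _ ≤ ∑ s ∈ Finset.range K, (G * ν.real (cyl L s) + 1) :=
            Finset.sum_le_sum fun s hs => (hw s (Finset.mem_range.1 hs)).2
        _ = _ := by rw [Finset.sum_add_distrib, h1]; simp
  set T : ℝ := Nat.cast (totalWeight K G x)
  have hT0 : 0 < T := hG0.trans_le hT.1
  -- The first term comes from rounding a weight, the second from normalizing by T instead of G.
  -- Each sums to K/G over s.
  have h2 : ∀ s ∈ Finset.range K, |(atomic A L G x).real (cyl L s) - ν.real (cyl L s)|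
      ≤ 1 / G + ν.real (cyl L s) * (K / G) := by
    intro s hs
    have hs' := Finset.mem_range.1 hs
    obtain ⟨hw1, hw2⟩ := hw s hs'
    have h3 : (atomic A L G x).real (cyl L s) - ν.real (cyl L s)
        = (weight G x s - T * ν.real (cyl L s)) / T := by
      rw [atomic_real_cyl L G x hs', sub_div, mul_div_cancel_left₀ _ hT0.ne']
    have h4 : |(weight G x s : ℝ) - T * ν.real (cyl L s)| ≤ 1 + ν.real (cyl L s) * K := by
      rw [abs_le]
      have := mul_le_mul_of_nonneg_right hT.1 (hp0 s)
      have := mul_le_mul_of_nonneg_right hT.2 (hp0 s)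
      have : 0 ≤ ν.real (cyl L s) * K := mul_nonneg (hp0 s) (Nat.cast_nonneg _)
      constructor <;> nlinarith
    rw [h3, abs_div, abs_of_pos hT0]
    calc _ ≤ (1 + ν.real (cyl L s) * K) / G :=
          div_le_div₀ (by have := mul_nonneg (hp0 s) (Nat.cast_nonneg (α := ℝ) K); linarith)
            h4 hG0 hT.1
      _ = _ := by ring
  calc ellDist L (atomic A L G x) ν ≤ ∑ s ∈ Finset.range K, (1 / G + ν.real (cyl L s) * (K / G)) :=
        Finset.sum_le_sum h2
    _ = _ := by
      rw [Finset.sum_add_distrib, ← Finset.sum_mul, hK, sum_real_cyl]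
      simp
      ring

theorem IsLocal.abs_integral_sub_le {L M : ℕ} {h : (ℤ → A) → ℝ} (hh : IsLocal M h) (hM : M ≤ L)
    (h1 : ∀ x, |h x| ≤ 1) (μ ν : Measure (ℤ → A)) [IsProbabilityMeasure μ]
    [IsProbabilityMeasure ν] : |∫ x, h x ∂μ - ∫ x, h x ∂ν| ≤ ellDist L μ ν := by
  rw [(hh.mono hM).integral_eq, (hh.mono hM).integral_eq, ← Finset.sum_sub_distrib]
  refine (Finset.abs_sum_le_sum_abs _ _).trans (Finset.sum_le_sum fun v _ => ?_)
  rw [← sub_mul, abs_mul]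
  exact mul_le_of_le_one_right (abs_nonneg _) (h1 _)

open Classical in
theorem IsLocal.abs_measureReal_sub_le {L M : ℕ} {S : Set (ℤ → A)} (hS : IsLocal M fun x => x ∈ S)
    (hM : M ≤ L) (μ ν : Measure (ℤ → A)) [IsProbabilityMeasure μ] [IsProbabilityMeasure ν] :
    |μ.real S - ν.real S| ≤ ellDist L μ ν := by
  rw [measureReal_eq_integral hS.measurableSet, measureReal_eq_integral hS.measurableSet]
  refine (isLocal_indicator hS).abs_integral_sub_le hM (fun x => ?_) μ ν
  split_ifs <;> simp

/-- Each long cylinder lies in exactly one short cylinder, so this is the triangle inequality after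
regrouping. -/
theorem ellDist_mono {L M : ℕ} (hM : M ≤ L) (μ ν : Measure (ℤ → A)) [IsProbabilityMeasure μ]
    [IsProbabilityMeasure ν] : ellDist M μ ν ≤ ellDist L μ ν := by
  classical
  unfold ellDist
  calc _ ≤ ∑ v ∈ Finset.range (Fintype.card A ^ M), ∑ s ∈ Finset.range (Fintype.card A ^ L),
        |μ.real (cyl L s) - ν.real (cyl L s)| * if (conf s : ℤ → A) ∈ cyl M v then 1 else 0 := by
        refine Finset.sum_le_sum fun v _ => ?_
        rw [((isLocal_cyl M v).mono hM).measureReal_eq, ((isLocal_cyl M v).mono hM).measureReal_eq,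
          ← Finset.sum_sub_distrib]
        refine (Finset.abs_sum_le_sum_abs _ _).trans (Finset.sum_le_sum fun s _ => ?_)
        rw [← sub_mul, abs_mul]
        split_ifs <;> simp
    _ = _ := by
        rw [Finset.sum_comm]
        refine Finset.sum_congr rfl fun s _ => ?_
        obtain ⟨v, hv, hx⟩ := exists_mem_cyl M (conf s : ℤ → A)
        rw [Finset.sum_eq_single v, if_pos hx, mul_one]
        · intro w hw hne
          rw [if_neg, mul_zero]
          exact fun h => hne (eq_of_mem_cyl (Finset.mem_range.1 hw) hv h hx)
        · exact fun h => absurd (Finset.mem_range.2 hv) h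

/-- The windows with n < k use at most 2k - 1 sites, and the factor 1/2 of total variation
compensates the sum of the 2⁻ⁿ. -/
theorem partialDist_le_ellDist {L k : ℕ} (hk : 2 * k ≤ L) (μ ν : Measure (ℤ → A))
    [IsProbabilityMeasure μ] [IsProbabilityMeasure ν] : partialDist k μ ν ≤ ellDist L μ ν := by
  have h0 : 0 ≤ ellDist L μ ν := Finset.sum_nonneg fun _ _ => abs_nonneg _
  calc partialDist k μ ν ≤ ∑ n ∈ Finset.range k, (1 / 2 : ℝ) ^ n * ((1 / 2) * ellDist L μ ν) := by
        refine Finset.sum_le_sum fun n hn => ?_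
        have := Finset.mem_range.1 hn
        gcongr
        exact mul_le_mul_of_nonneg_left (ellDist_mono (by omega) μ ν) (by norm_num)
    _ = (∑ n ∈ Finset.range k, (1 / 2 : ℝ) ^ n) * ((1 / 2) * ellDist L μ ν) := by
        rw [Finset.sum_mul]
    _ ≤ 2 * ((1 / 2) * ellDist L μ ν) := by
        gcongr
        exact sum_geometric_two_le k
    _ = _ := by ring

/-- Every measure is a limit of finitely supported ones. -/
theorem exists_atomic_measureDist_lt (ν : Measure (ℤ → A)) [IsProbabilityMeasure ν] {δ : ℝ}
    (hδ : 0 < δ) : ∃ L G x, measureDist (atomic A L G x) ν ≤ δ := by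
  obtain ⟨k, hk⟩ := exists_pow_lt_of_lt_one (show 0 < δ / 4 by positivity)
    (show (1 / 2 : ℝ) < 1 by norm_num)
  obtain ⟨G, hG⟩ := exists_nat_gt (2 * (Fintype.card A ^ (2 * k) : ℕ) / (δ / 2) : ℝ)
  have hG0 : (0 : ℝ) < G := lt_of_le_of_lt (by positivity) hG
  obtain ⟨x, -, hx⟩ := exists_atomic ν (2 * k) (G := G) (by exact_mod_cast hG0)
  refine ⟨2 * k, G, x, ?_⟩
  have h1 := measureDist_le_partialDist k (atomic A (2 * k) G x) ν
  have h2 := partialDist_le_ellDist (le_refl (2 * k)) (atomic A (2 * k) G x) ν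
  have h3 : (2 * (Fintype.card A ^ (2 * k) : ℕ) / G : ℝ) ≤ δ / 2 := by
    rw [div_le_iff₀ hG0]
    rw [div_lt_iff₀ (by positivity)] at hG
    linarith
  linarith

end Distance
/-! ### Computability of the measures of cylinders -/

section Families

variable {A : Type*} [Fintype A] [Nonempty A] {Z : Type*} [Primcodable Z]

theorem computable_cell_site_add (t : ℤ) {f : Z → ℕ} (hf : Computable f) :
    Computable fun z => cell (site (f z) + t) := by
  refine Computable.comp (f := fun j : ℕ => cell (site j + t)) ?_ hf
  have he : ComputablePred fun j : ℕ => j % 2 = 0 := computablePred_eq (by fun_prop) (by fun_prop)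
  rcases Int.eq_nat_or_neg t with ⟨n, rfl | rfl⟩
  · refine (computable_ite (p := fun j : ℕ => j % 2 = 0) he
      (f := fun j => j + 2 * n) (by fun_prop)
      (g := fun j => if j / 2 + 1 ≤ n then 2 * (n - (j / 2 + 1)) else 2 * (j / 2 + 1 - n) - 1)
      (computable_ite (computablePred_le (by fun_prop) (by fun_prop)) (by fun_prop)
        (by fun_prop))).of_eq fun j => ?_
    unfold cell site
    split_ifs <;> omega
  · refine (computable_ite (p := fun j : ℕ => j % 2 = 0) he
      (f := fun j => if n ≤ j / 2 then j - 2 * n else 2 * (n - j / 2) - 1)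
      (computable_ite (computablePred_le (by fun_prop) (by fun_prop)) (by fun_prop)
        (by fun_prop)) (g := fun j => j + 2 * n) (by fun_prop)).of_eq fun j => ?_
    unfold cell site
    split_ifs <;> omega

theorem conf_eq_conf_iff (s v : ℕ) (i : ℤ) (j : ℕ) : (conf s : ℤ → A) i = conf v (site j) ↔
    s / Fintype.card A ^ cell i % Fintype.card A = v / Fintype.card A ^ j % Fintype.card A := by
  rw [conf_site, conf, ← num_injective.eq_iff, num_letter, num_letter]

theorem computablePred_conf_mem_cyl {m v s : Z → ℕ} (hm : Computable m) (hv : Computable v)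
    (hs : Computable s) : ComputablePred fun z => (conf (s z) : ℤ → A) ∈ cyl (m z) (v z) := by
  refine (computablePred_forall_lt (p := fun z j => s z / Fintype.card A ^ j % Fintype.card A
    = v z / Fintype.card A ^ j % Fintype.card A)
    (computablePred_eq (by fun_prop) (by fun_prop)) hm).of_eq fun z => ?_
  refine forall₂_congr fun j hj => ?_
  rw [conf_eq_conf_iff, cell_site]

theorem computablePred_shift_conf_mem_cyl {m v s : Z → ℕ} (hm : Computable m) (hv : Computable v)
    (hs : Computable s) :
    ComputablePred fun z => (conf (s z) : ℤ → A) ∈ shift ⁻¹' cyl (m z) (v z) := by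
  have h := computable_cell_site_add 1 (f := fun z : Z × ℕ => z.2) (by fun_prop)
  refine (computablePred_forall_lt
    (p := fun z j => s z / Fintype.card A ^ cell (site j + 1) % Fintype.card A
      = v z / Fintype.card A ^ j % Fintype.card A)
    (computablePred_eq (by fun_prop) (by fun_prop)) hm).of_eq fun z => ?_
  refine forall₂_congr fun j hj => ?_
  rw [← conf_eq_conf_iff (A := A)]
  rfl

/-- The table is only computable entry by entry. Each factor is therefore written as a finite sum
over all entries, where indicators given by comparisons of digits select the right one. -/
theorem isRatComputable_blk {N : Finset ℤ} {ψ : Z → (N → A) → A → ℝ}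
    (hψ : ∀ u a, IsRatComputable fun z => ψ z u a) {m v s : Z → ℕ} (hm : Computable m)
    (hv : Computable v) (hs : Computable s) :
    IsRatComputable fun z => blk (ψ z) (m z) (v z) (conf (s z)) := by
  classical
  refine IsRatComputable.prod_range
    (f := fun z j => ψ z (patternAt N (conf (s z)) (site j)) (conf (v z) (site j))) ?_ hm
  have h0 : ∀ (u : N → A) (b : A), IsRatComputable fun p : Z × ℕ =>
      (∏ t : N, if s p.1 / Fintype.card A ^ cell (site p.2 + t) % Fintype.card A = num (u t)
        then (1 : ℝ) else 0) *
      (if v p.1 / Fintype.card A ^ p.2 % Fintype.card A = num b then 1 else 0) * ψ p.1 u b := by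
    intro u b
    refine IsRatComputable.mul (IsRatComputable.mul ?_ ?_) ((hψ u b).comp Computable.fst)
    · refine IsRatComputable.finset_prod _ fun t => IsRatComputable.indicator ?_
      have h := computable_cell_site_add (t : ℤ) (f := fun z : Z × ℕ => z.2) (by fun_prop)
      exact computablePred_eq (by fun_prop) (by fun_prop)
    · exact IsRatComputable.indicator (computablePred_eq (by fun_prop) (by fun_prop))
  refine (IsRatComputable.finset_sum Finset.univ fun u =>
    IsRatComputable.finset_sum Finset.univ fun b => h0 u b).of_eq fun p => ?_
  have h1 : ∀ u : N → A, (∏ t : N, if s p.1 / Fintype.card A ^ cell (site p.2 + t)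
      % Fintype.card A = num (u t) then (1 : ℝ) else 0)
      = if patternAt N (conf (s p.1)) (site p.2) = u then 1 else 0 := by
    intro u
    rw [Finset.prod_ite_zero]
    simp only [Finset.prod_const_one, Finset.mem_univ, true_imp_iff]
    congr 1
    rw [funext_iff, eq_iff_iff]
    refine forall_congr' fun t => ?_
    rw [patternAt, conf, ← (num_injective (A := A)).eq_iff, num_letter]
  have h2 : ∀ b : A, (v p.1 / Fintype.card A ^ p.2 % Fintype.card A = num b)
      = (conf (v p.1) (site p.2) = b) := by
    intro b
    rw [conf_site, ← (num_injective (A := A)).eq_iff, num_letter]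
  simp only [h1, h2]
  rw [Finset.sum_eq_single (patternAt N (conf (s p.1)) (site p.2)),
    Finset.sum_eq_single (conf (v p.1) (site p.2))]
  · simp
  · intro b _ hb
    simp [hb.symm]
  · simp
  · intro u _ hu
    simp [hu.symm]
  · simp

variable [MeasurableSpace A] [DiscreteMeasurableSpace A]

/-- The measures of cylinders are rational numbers that can be computed uniformly. -/
def IsComputableFamily (q : Z → Measure (ℤ → A)) : Prop :=
  IsRatComputable fun p : Z × ℕ × ℕ => (q p.1).real (cyl p.2.1 p.2.2)

theorem IsComputableFamily.comp {q : Z → Measure (ℤ → A)} (hq : IsComputableFamily q)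
    {Y : Type*} [Primcodable Y] {g : Y → Z} (hg : Computable g) :
    IsComputableFamily fun y => q (g y) :=
  IsRatComputable.comp hq (g := fun p : Y × ℕ × ℕ => (g p.1, p.2)) (by fun_prop)

theorem IsComputableFamily.partialDist {q q' : Z → Measure (ℤ → A)} (hq : IsComputableFamily q)
    (hq' : IsComputableFamily q') {k : Z → ℕ} (hk : Computable k) :
    IsRatComputable fun z => partialDist (k z) (q z) (q' z) := by
  unfold NoisyCA.partialDist cylDist
  refine IsRatComputable.sum_range (IsRatComputable.mul
    (IsRatComputable.half_pow (by fun_prop)) (IsRatComputable.mul ?_ ?_)) hk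
  · exact (IsRatComputable.half_pow (Computable.const 1)).of_eq fun _ => by simp
  · refine IsRatComputable.sum_range ?_ (by fun_prop)
    have hg : Computable fun p : (Z × ℕ) × ℕ => (p.1.1, 2 * p.1.2 + 1, p.2) := by fun_prop
    exact ((IsRatComputable.comp hq hg).sub (IsRatComputable.comp hq' hg)).abs

theorem computable_weight {G x s : Z → ℕ} (hG : Computable G) (hx : Computable x)
    (hs : Computable s) : Computable fun z => weight (G z) (x z) (s z) := by
  unfold weight
  fun_prop

theorem isRatComputable_atomic_sum {L G x : Z → ℕ} (hL : Computable L) (hG : Computable G)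
    (hx : Computable x) {h : Z → ℕ → ℝ} (hh : IsRatComputable fun p : Z × ℕ => h p.1 p.2) :
    IsRatComputable fun z => (totalWeight (Fintype.card A ^ L z) (G z) (x z) : ℝ)⁻¹ *
      ∑ s ∈ Finset.range (Fintype.card A ^ L z), (weight (G z) (x z) s : ℝ) * h z s := by
  have hw := computable_weight (Z := Z × ℕ) (G := fun p => G p.1) (x := fun p => x p.1)
    (s := fun p => p.2) (by fun_prop) (by fun_prop) (by fun_prop)
  refine IsRatComputable.mul (IsRatComputable.inv_natCast ?_)
    (IsRatComputable.sum_range ((IsRatComputable.natCast hw).mul hh) (by fun_prop))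
  exact computable_sum_range hw (by fun_prop)

theorem isRatComputable_atomic_cyl {L G x m v : Z → ℕ} (hL : Computable L) (hG : Computable G)
    (hx : Computable x) (hm : Computable m) (hv : Computable v) :
    IsRatComputable fun z => (atomic A (L z) (G z) (x z)).real (cyl (m z) (v z)) := by
  classical
  refine (isRatComputable_atomic_sum hL hG hx (A := A)
    (h := fun z s => if (conf s : ℤ → A) ∈ cyl (m z) (v z) then 1 else 0)
    (IsRatComputable.indicator (computablePred_conf_mem_cyl (A := A) (Z := Z × ℕ) (m := fun p => m p.1)
      (v := fun p => v p.1) (s := fun p => p.2) (by fun_prop) (by fun_prop) (by fun_prop)))).of_eq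
    fun z => ?_
  rw [(isLocal_cyl _ _).atomic_real]

theorem isRatComputable_atomic_shift_cyl {L G x m v : Z → ℕ} (hL : Computable L)
    (hG : Computable G) (hx : Computable x) (hm : Computable m) (hv : Computable v) :
    IsRatComputable fun z => (atomic A (L z) (G z) (x z)).real (shift ⁻¹' cyl (m z) (v z)) := by
  classical
  refine (isRatComputable_atomic_sum hL hG hx (A := A)
    (h := fun z s => if (conf s : ℤ → A) ∈ shift ⁻¹' cyl (m z) (v z) then 1 else 0)
    (IsRatComputable.indicator (computablePred_shift_conf_mem_cyl (A := A) (Z := Z × ℕ) (m := fun p => m p.1)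
      (v := fun p => v p.1) (s := fun p => p.2) (by fun_prop) (by fun_prop) (by fun_prop)))).of_eq
    fun z => ?_
  rw [(isLocal_shift _ _).atomic_real]

theorem isRatComputable_atomic_blk {N : Finset ℤ} {ψ : Z → (N → A) → A → ℝ}
    (hψ : ∀ u a, IsRatComputable fun z => ψ z u a) {L G x m v : Z → ℕ} (hL : Computable L)
    (hG : Computable G) (hx : Computable x) (hm : Computable m) (hv : Computable v) :
    IsRatComputable fun z => ∫ y, blk (ψ z) (m z) (v z) y ∂atomic A (L z) (G z) (x z) := by
  refine (isRatComputable_atomic_sum hL hG hx (A := A)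
    (h := fun z s => blk (ψ z) (m z) (v z) (conf s : ℤ → A)) (isRatComputable_blk (A := A) (Z := Z × ℕ)
    (ψ := fun p => ψ p.1) (fun u a => (hψ u a).comp Computable.fst) (m := fun p => m p.1)
      (v := fun p => v p.1) (s := fun p => p.2) (by fun_prop) (by fun_prop) (by fun_prop))).of_eq
    fun z => ?_
  rw [(isLocal_blk _ _ _).integral_atomic]

theorem isComputableFamily_atomic {L G x : Z → ℕ} (hL : Computable L) (hG : Computable G)
    (hx : Computable x) : IsComputableFamily fun z => atomic A (L z) (G z) (x z) :=
  isRatComputable_atomic_cyl (Z := Z × ℕ × ℕ) (by fun_prop) (by fun_prop) (by fun_prop)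
    (by fun_prop) (by fun_prop)

/-- Modulo the length ℓ, subtracting j/2 + 1 is adding (ℓ - 1)(j/2 + 1), so the index is computed
within ℕ. -/
theorem periodicConfig_site_add {B : Type*} (w : B × List B) (j k : ℕ) :
    periodicConfig w (site j + k) = (wordOf w).getD (if j % 2 = 0
      then (j / 2 + k) % (wordOf w).length
      else (k + ((wordOf w).length - 1) * (j / 2 + 1)) % (wordOf w).length) w.1 := by
  have hl : 0 < (wordOf w).length := by simp [wordOf]
  unfold periodicConfig
  congr 1
  obtain ⟨l, hl'⟩ : ∃ l, (wordOf w).length = l + 1 := ⟨_, (Nat.succ_pred_eq_of_pos hl).symm⟩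
  rw [hl', site]
  split_ifs with h
  · rw [← Nat.cast_add, ← Int.natCast_mod, Int.toNat_natCast]
  · have h1 : (-((j / 2 : ℕ) : ℤ) - 1 + k) % ((l + 1 : ℕ) : ℤ)
        = ((k + (l + 1 - 1) * (j / 2 + 1) : ℕ) : ℤ) % ((l + 1 : ℕ) : ℤ) := by
      refine Int.modEq_iff_dvd.2 ⟨(j / 2 : ℕ) + 1, ?_⟩
      push_cast
      ring
    rw [h1, ← Int.natCast_mod, Int.toNat_natCast]

theorem computable_periodic_index {j k l : Z → ℕ} (hj : Computable j) (hk : Computable k)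
    (hl : Computable l) : Computable fun z => if j z % 2 = 0 then (j z / 2 + k z) % l z
      else (k z + (l z - 1) * (j z / 2 + 1)) % l z :=
  computable_ite (computablePred_eq (by fun_prop) (by fun_prop)) (by fun_prop) (by fun_prop)

/-- The mass of a cylinder is the proportion of the shifts k < |w| that land in it, which is decided
by comparing digits. The arbitrary numbering `num` is harmless, since every map on a finite type is
computable. -/
theorem isComputableFamily_periodicMeasure [Primcodable A] :
    IsComputableFamily fun w : A × List A => (periodicMeasure w).toMeasure := by
  classical
  have hword : Computable fun w : A × List A => wordOf w := by
    unfold wordOf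
    fun_prop
  have hlen : Computable fun w : A × List A => (wordOf w).length := by fun_prop
  have h0 : ComputablePred fun p : ((A × List A) × ℕ × ℕ) × ℕ =>
      shift^[p.2] (periodicConfig p.1.1) ∈ cyl p.1.2.1 p.1.2.2 := by
    refine (computablePred_forall_lt (α := ((A × List A) × ℕ × ℕ) × ℕ)
      (p := fun p j => num ((wordOf p.1.1).getD (if j % 2 = 0
        then (j / 2 + p.2) % (wordOf p.1.1).length
        else (p.2 + ((wordOf p.1.1).length - 1) * (j / 2 + 1)) % (wordOf p.1.1).length) p.1.1.1)
        = p.1.2.2 / Fintype.card A ^ j % Fintype.card A)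
      (n := fun p => p.1.2.1) ?_ (by fun_prop)).of_eq fun p => ?_
    · have hw : Computable fun x : (((A × List A) × ℕ × ℕ) × ℕ) × ℕ => x.1.1.1 := by fun_prop
      have hi := computable_periodic_index (Z := (((A × List A) × ℕ × ℕ) × ℕ) × ℕ)
        (j := fun x => x.2) (k := fun x => x.1.2) (l := fun x => (wordOf x.1.1.1).length)
        (by fun_prop) (by fun_prop) (hlen.comp hw)
      exact computablePred_eq (computable_of_finite (f := num) (computable_listGetD
        (hword.comp hw) hi (Computable.fst.comp hw))) (by fun_prop)
    · refine forall₂_congr fun j hj => ?_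
      rw [shift_iterate, periodicConfig_site_add, conf_site, ← (num_injective (A := A)).eq_iff,
        num_letter]
  have h1 : Computable fun p : (A × List A) × ℕ × ℕ => (wordOf p.1).length :=
    hlen.comp Computable.fst
  refine ((IsRatComputable.inv_natCast h1).mul
    (IsRatComputable.sum_range
    (f := fun p k => if shift^[k] (periodicConfig p.1) ∈ cyl p.2.1 p.2.2 then 1 else 0)
    (IsRatComputable.indicator h0) h1)).of_eq fun p => ?_
  change _ = (periodicMeasureAux p.1).real (cyl p.2.1 p.2.2)
  simp only [periodicMeasureAux, Measure.real, Measure.smul_apply, Measure.finsetSum_apply,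
    smul_eq_mul, ENNReal.toReal_mul, ENNReal.toReal_inv, ENNReal.toReal_natCast,
    Measure.dirac_apply' _ (measurableSet_cyl _ _)]
  rw [ENNReal.toReal_sum]
  · congr 1
    refine Finset.sum_congr rfl fun k _ => ?_
    simp only [indicator]
    split_ifs <;> simp
  · intro k _
    simp only [indicator]
    split_ifs <;> simp

end Families
/-! ### Invariant measures near a given measure -/

section Approximation

variable {A : Type*} [Fintype A] [Nonempty A] {N : Finset ℤ}

theorem blk_nonneg {ψ : (N → A) → A → ℝ} (hψ : ∀ u a, 0 ≤ ψ u a) (m v : ℕ) (x : ℤ → A) :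
    0 ≤ blk ψ m v x := Finset.prod_nonneg fun _ _ => hψ _ _

theorem blk_le_one {ψ : (N → A) → A → ℝ} (hψ : ∀ u a, 0 ≤ ψ u a) (hψ' : ∀ u a, ψ u a ≤ 1)
    (m v : ℕ) (x : ℤ → A) : blk ψ m v x ≤ 1 :=
  Finset.prod_le_one (fun _ _ => hψ _ _) fun _ _ => hψ' _ _

theorem abs_blk_le_one {ψ : (N → A) → A → ℝ} (hψ : ∀ u a, 0 ≤ ψ u a) (hψ' : ∀ u a, ψ u a ≤ 1)
    (m v : ℕ) (x : ℤ → A) : |blk ψ m v x| ≤ 1 := by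
  rw [abs_of_nonneg (blk_nonneg hψ m v x)]
  exact blk_le_one hψ hψ' m v x

/-- Factors are replaced one at a time; each replacement costs δ because the others have absolute
value at most 1. -/
theorem abs_blk_sub_le {ψ φ : (N → A) → A → ℝ} (hψ : ∀ u a, 0 ≤ ψ u a) (hψ' : ∀ u a, ψ u a ≤ 1)
    (hφ : ∀ u a, 0 ≤ φ u a) (hφ' : ∀ u a, φ u a ≤ 1) {δ : ℝ} (h : ∀ u a, |ψ u a - φ u a| ≤ δ)
    (m v : ℕ) (x : ℤ → A) : |blk ψ m v x - blk φ m v x| ≤ m * δ := by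
  induction m with
  | zero => simp [blk]
  | succ m ih =>
    have hs : ∀ χ : (N → A) → A → ℝ, blk χ (m + 1) v x
        = blk χ m v x * χ (patternAt N x (site m)) (conf v (site m)) := fun χ =>
      Finset.prod_range_succ _ _
    rw [hs, hs]
    set a := ψ (patternAt N x (site m)) (conf v (site m))
    set b := φ (patternAt N x (site m)) (conf v (site m))
    have h1 : blk ψ m v x * a - blk φ m v x * b
        = (blk ψ m v x - blk φ m v x) * a + blk φ m v x * (a - b) := by ring
    rw [h1]
    refine (abs_add_le _ _).trans ?_
    rw [abs_mul, abs_mul]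
    have h2 : |a| ≤ 1 := by
      rw [abs_of_nonneg (hψ _ _)]
      exact hψ' _ _
    have h3 := mul_le_of_le_one_right (abs_nonneg (blk ψ m v x - blk φ m v x)) h2
    have h4 := mul_le_of_le_one_left (abs_nonneg (a - b)) (abs_blk_le_one hφ hφ' m v x)
    have h5 : |a - b| ≤ δ := h _ _
    push_cast
    linarith

variable [MeasurableSpace A] [DiscreteMeasurableSpace A]

/-- The measure `μ` is invariant, up to `2⁻ᵏ` on the first cylinders, under the shift and the
rule `ψ`. -/
def IsAlmostInvariant (ψ : (N → A) → A → ℝ) (k : ℕ) (μ : Measure (ℤ → A)) : Prop :=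
  ∀ m < k, ∀ v < k,
    |μ.real (shift ⁻¹' cyl m v) - μ.real (cyl m v)| ≤ (1 / 2 : ℝ) ^ k ∧
    |∫ x, blk ψ m v x ∂μ - μ.real (cyl m v)| ≤ (1 / 2 : ℝ) ^ k

/-- Passing from μ to ν costs 2⁻ᵏ/4 in each of the two terms, and passing from ψ to φ costs at most
2⁻ᵏ/8 because m < k ≤ 2ᵏ. The length L exceeds the locality of all functions involved. -/
theorem isAlmostInvariant_of_ellDist_le {φ : StochasticRule A N} {ν : ShiftMeasure A}
    (hν : ν ∈ φ.invariantMeasures) {ψ : (N → A) → A → ℝ} (hψ : ∀ u a, 0 ≤ ψ u a)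
    (hψ' : ∀ u a, ψ u a ≤ 1) {k : ℕ}
    (h : ∀ u a, |ψ u a - φ.realProb u a| ≤ (1 / 2 : ℝ) ^ (2 * k + 3)) {μ : Measure (ℤ → A)}
    [IsProbabilityMeasure μ] {L : ℕ} (hL : 2 * k + 2 * radius N + 4 ≤ L)
    (hμ : ellDist L μ ν.toMeasure ≤ (1 / 2 : ℝ) ^ (k + 2)) : IsAlmostInvariant ψ k μ := by
  intro m hm v _
  have hk : (1 / 2 : ℝ) ^ (k + 2) = (1 / 2 : ℝ) ^ k / 4 := by ring
  have h0 : 0 < (1 / 2 : ℝ) ^ k := by positivity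
  have h1 := (isLocal_cyl m v).abs_measureReal_sub_le (L := L) (by omega) μ ν.toMeasure
  have h2 := (isLocal_shift m v).abs_measureReal_sub_le (L := L) (by omega) μ ν.toMeasure
  have h3 := (isLocal_blk ψ m v).abs_integral_sub_le (L := L) (by omega)
    (abs_blk_le_one hψ hψ' m v) μ ν.toMeasure
  rw [ν.real_shift_cyl] at h2
  rw [abs_le] at h1 h2 h3
  constructor
  · rw [abs_le]
    constructor <;> linarith
  · have h4 : |∫ x, blk ψ m v x ∂ν.toMeasure - ∫ x, blk φ.realProb m v x ∂ν.toMeasure|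
        ≤ (1 / 2 : ℝ) ^ k / 8 := by
      rw [← integral_sub ((isLocal_blk ψ m v).integrable _) ((isLocal_blk _ m v).integrable _)]
      refine (norm_integral_le_of_norm_le_const
        (f := fun x => blk ψ m v x - blk φ.realProb m v x) (C := m * (1 / 2 : ℝ) ^ (2 * k + 3))
        (ae_of_all _ fun x => abs_blk_sub_le hψ hψ' φ.realProb_nonneg φ.realProb_le_one h m v x)).trans
        ?_
      have h5 : (m : ℝ) ≤ 2 ^ k := by
        exact_mod_cast (hm.trans Nat.lt_two_pow_self).le
      have h6 : (2 : ℝ) ^ k * (1 / 2 : ℝ) ^ k = 1 := by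
        rw [← mul_pow]
        norm_num
      have h7 : (1 / 2 : ℝ) ^ (2 * k + 3) = (1 / 2) ^ k * (1 / 2) ^ k / 8 := by ring
      rw [probReal_univ, mul_one, h7]
      calc (m : ℝ) * ((1 / 2) ^ k * (1 / 2) ^ k / 8)
          ≤ 2 ^ k * ((1 / 2) ^ k * (1 / 2) ^ k / 8) := by gcongr
        _ = (2 ^ k * (1 / 2) ^ k) * (1 / 2) ^ k / 8 := by ring
        _ = _ := by rw [h6, one_mul]
    rw [(φ.mem_invariantMeasures_iff ν).1 hν] at h4
    rw [abs_le] at h4 ⊢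
    constructor <;> linarith

/-- A compactness criterion for the existence of an invariant measure near `q`. -/
theorem exists_invariant_of_isAlmostInvariant (U : Ultrafilter ℕ) (hU : (U : Filter ℕ) ≤ atTop)
    (μ : ℕ → Measure (ℤ → A)) [∀ k, IsProbabilityMeasure (μ k)] {ψ : ℕ → (N → A) → A → ℝ}
    {φ : StochasticRule A N}
    (hψ : ∀ u a, Tendsto (fun k => ψ k u a) U (𝓝 (φ.realProb u a)))
    (h : ∀ k, IsAlmostInvariant (ψ k) k (μ k)) {q : Measure (ℤ → A)} [IsProbabilityMeasure q]
    {r : ℝ} (hq : ∀ k, partialDist k (μ k) q ≤ r + (1 / 2 : ℝ) ^ k) :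
    ∃ ν ∈ φ.invariantMeasures, measureDist ν.toMeasure q ≤ r := by
  have h0 : Tendsto (fun k : ℕ => (1 / 2 : ℝ) ^ k) U (𝓝 0) :=
    (tendsto_pow_atTop_nhds_zero_of_lt_one (by norm_num) (by norm_num)).mono_left hU
  -- A given pair (m, v) is tested at every level k > max m v, so its defects tend to 0.
  obtain ⟨ν, hν, hlim⟩ := exists_invariant_of_tendsto U μ ψ φ hψ
    (fun m v => squeeze_zero_norm' (by
      filter_upwards [hU (eventually_gt_atTop (max m v))] with k hk
      exact (h k m (lt_of_le_of_lt (le_max_left _ _) hk) v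
        (lt_of_le_of_lt (le_max_right _ _) hk)).1) h0)
    (fun m v => squeeze_zero_norm' (by
      filter_upwards [hU (eventually_gt_atTop (max m v))] with k hk
      exact (h k m (lt_of_le_of_lt (le_max_left _ _) hk) v
        (lt_of_le_of_lt (le_max_right _ _) hk)).2) h0)
  refine ⟨ν, hν, measureDist_le_of_tendsto hU hlim (r := fun k => r + (1 / 2 : ℝ) ^ k) ?_ hq⟩
  simpa using h0.const_add r

end Approximation

/-! ### Computable perturbations and the Π₁ test -/

section Perturbations

variable {A : Type*} [Fintype A] {F : CellularAutomaton A}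
  {P : Perturbation F}

/-- There are finitely many entries, and the sum of their moduli dominates each one, so it is a
common modulus. -/
theorem Perturbation.IsComputable.exists_modulus (hP : P.IsComputable) :
    ∃ α : ℕ → ℕ, Computable α ∧ ∀ (n : ℕ) (s t : unitInterval), dist s t ≤ (1 / 2 : ℝ) ^ α n →
      ∀ u a, |(P.rule s).realProb u a - (P.rule t).realProb u a| ≤ (1 / 2 : ℝ) ^ n := by
  classical
  choose α hα h using fun (i : (F.nbhd → A) × A) => (hP i.1 i.2).1
  refine ⟨fun n => ∑ i, α i n, computable_fintype_sum _ hα, fun n s t hst u a => ?_⟩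
  refine h (u, a) n s t (hst.trans ?_)
  refine pow_le_pow_of_le_one (by norm_num) (by norm_num) ?_
  exact Finset.single_le_sum (f := fun i => α i n) (fun _ _ => Nat.zero_le _)
    (Finset.mem_univ (u, a))

/-- The approximate entries stay in [0, 1], as the bounds on `blk` require. The approximate rows
need not sum to 1, which is why `blk` takes arbitrary tables. -/
theorem Perturbation.IsComputable.exists_values (hP : P.IsComputable) :
    ∃ β : (F.nbhd → A) → A → (ℕ × ℕ) × ℕ → ℝ, (∀ u a, IsRatComputable (β u a)) ∧
      (∀ u a z, 0 ≤ β u a z) ∧ (∀ u a z, β u a z ≤ 1) ∧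
      ∀ u a c n, |β u a (c, n) - (P.rule (unitRatOfCode c)).realProb u a| ≤ (1 / 2 : ℝ) ^ n := by
  choose β hβ h using fun u a => (hP u a).2
  refine ⟨fun u a z => (unitRatOfCode (β u a z) : ℝ),
    fun u a => isRatComputable_unitRatOfCode.comp (hβ u a), fun u a z => (unitRatOfCode _).2.1,
    fun u a z => (unitRatOfCode _).2.2, fun u a c n => ?_⟩
  rw [abs_sub_comm]
  exact h u a c n

theorem Perturbation.IsComputable.tendsto_realProb (hP : P.IsComputable) {l : Filter ℕ}
    {s : ℕ → unitInterval} {t : unitInterval} (h : Tendsto s l (𝓝 t)) (u : F.nbhd → A) (a : A) :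
    Tendsto (fun k => (P.rule (s k)).realProb u a) l (𝓝 ((P.rule t).realProb u a)) := by
  obtain ⟨α, -, hα⟩ := hP.exists_modulus
  rw [Metric.tendsto_nhds]
  intro δ hδ
  obtain ⟨n, hn⟩ := exists_pow_lt_of_lt_one hδ (show (1 / 2 : ℝ) < 1 by norm_num)
  filter_upwards [Metric.tendsto_nhds.1 h ((1 / 2 : ℝ) ^ α n) (by positivity)] with k hk
  exact (hα n _ _ hk.le u a).trans_lt hn

/-- Every parameter is close to a parameter with a given denominator. -/
theorem exists_unitRatOfCode_near (ε : unitInterval) (E : ℕ) :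
    ∃ j < E + 2, |(unitRatOfCode (j, E) : ℝ) - ε| ≤ 1 / ((E : ℝ) + 1) := by
  have hE : (0 : ℝ) < (E : ℝ) + 1 := by positivity
  have h1 : ⌊(ε : ℝ) * (E + 1)⌋₊ ≤ E + 1 := by
    refine Nat.floor_le_of_le ?_
    push_cast
    exact mul_le_of_le_one_left hE.le ε.2.2
  refine ⟨⌊(ε : ℝ) * (E + 1)⌋₊, by omega, ?_⟩
  have h2 : (unitRatOfCode (⌊(ε : ℝ) * (E + 1)⌋₊, E) : ℝ)
      = (⌊(ε : ℝ) * (E + 1)⌋₊ : ℝ) / ((E : ℝ) + 1) := by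
    simp [unitRatOfCode, min_eq_left h1]
  have h3 := Nat.floor_le (mul_nonneg ε.2.1 hE.le)
  have h4 := (Nat.lt_floor_add_one ((ε : ℝ) * (E + 1))).le
  have h5 : (⌊(ε : ℝ) * (E + 1)⌋₊ : ℝ) / ((E : ℝ) + 1) - ε
      = (⌊(ε : ℝ) * (E + 1)⌋₊ - (ε : ℝ) * (E + 1)) / ((E : ℝ) + 1) := by
    rw [sub_div, mul_div_cancel_right₀ _ hE.ne']
  rw [h2, h5, abs_div, abs_of_pos hE]
  gcongr
  rw [abs_le]
  constructor <;> linarith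

variable [Nonempty A] [MeasurableSpace A] [DiscreteMeasurableSpace A]

/-- The existence of an invariant measure near a measure from a computable family, for a parameter
in a computable interval, is a `Π₁` property. -/
theorem exists_test (hP : P.IsComputable) {ι : Type*} [Primcodable ι] {q : ι → Measure (ℤ → A)}
    [∀ i, IsProbabilityMeasure (q i)] (hq : IsComputableFamily q) {r a b : ι → ℝ}
    (hr : IsRatComputable r) (ha : IsRatComputable a) (hb : IsRatComputable b) :
    ∃ T : ι → ℕ → Prop, ComputablePred (fun t : ι × ℕ => T t.1 t.2) ∧ ∀ i,
      (∃ ε : unitInterval, a i ≤ ε ∧ (ε : ℝ) ≤ b i ∧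
        ∃ ν ∈ P.invariantSet ε, measureDist ν.toMeasure (q i) ≤ r i) ↔ ∀ k, T i k := by
  obtain ⟨α, hα, hmod⟩ := hP.exists_modulus
  obtain ⟨β, hβ, hβ0, hβ1, hval⟩ := hP.exists_values
  -- `L` is the length required by `isAlmostInvariant_of_ellDist_le`, `G` makes the error of
  -- `exists_atomic` equal to 2^-(k+2), and `E` makes the mesh of parameters finer than both 2⁻ᵏ and
  -- the modulus at precision 2k + 4.
  let L : ℕ → ℕ := fun k => 2 * k + 2 * radius F.nbhd + 4
  let G : ℕ → ℕ := fun k => 2 ^ (k + 3) * Fintype.card A ^ L k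
  let E : ℕ → ℕ := fun k => 2 ^ (α (2 * k + 4) + k)
  have hL : Computable L := by fun_prop
  have hG : Computable G := by fun_prop
  have hE : Computable E := by fun_prop
  let T : ι → ℕ → Prop := fun i k =>
    ∃ x < (G k + 1) ^ (Fintype.card A ^ L k), ∃ j < E k + 2,
      a i ≤ (unitRatOfCode (j, E k) : ℝ) + (1 / 2 : ℝ) ^ k ∧
      (unitRatOfCode (j, E k) : ℝ) ≤ b i + (1 / 2 : ℝ) ^ k ∧
      partialDist k (atomic A (L k) (G k) x) (q i) ≤ r i + (1 / 2 : ℝ) ^ k ∧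
      IsAlmostInvariant (fun u a => β u a ((j, E k), 2 * k + 4)) k (atomic A (L k) (G k) x)
  refine ⟨T, ?_, fun i => ⟨?_, fun h => ?_⟩⟩
  · have hu : IsRatComputable fun y : ((ι × ℕ) × ℕ) × ℕ =>
        (unitRatOfCode (y.2, E y.1.1.2) : ℝ) :=
      isRatComputable_unitRatOfCode.comp (g := fun y : ((ι × ℕ) × ℕ) × ℕ => (y.2, E y.1.1.2))
        (by fun_prop)
    have hi : Computable fun y : ((ι × ℕ) × ℕ) × ℕ => y.1.1.1 := by fun_prop
    have hk : IsRatComputable fun y : ((ι × ℕ) × ℕ) × ℕ => (1 / 2 : ℝ) ^ y.1.1.2 :=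
      IsRatComputable.half_pow (by fun_prop)
    refine computablePred_exists_lt (α := ι × ℕ) (computablePred_exists_lt (α := (ι × ℕ) × ℕ)
      (computablePred_and ?_ (computablePred_and ?_ (computablePred_and ?_ ?_))) (by fun_prop))
      (by fun_prop)
    · exact (ha.comp hi).computablePred_le (hu.add hk)
    · exact hu.computablePred_le ((hb.comp hi).add hk)
    · exact (IsComputableFamily.partialDist
        (isComputableFamily_atomic (Z := ((ι × ℕ) × ℕ) × ℕ) (L := fun y => L y.1.1.2)
          (G := fun y => G y.1.1.2) (x := fun y => y.1.2) (by fun_prop) (by fun_prop)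
          (by fun_prop)) (hq.comp hi) (k := fun y => y.1.1.2) (by fun_prop)).computablePred_le
        ((hr.comp hi).add hk)
    · have hk' : IsRatComputable fun y : ((((ι × ℕ) × ℕ) × ℕ) × ℕ) × ℕ =>
          (1 / 2 : ℝ) ^ y.1.1.1.1.2 := IsRatComputable.half_pow (by fun_prop)
      have hc := isRatComputable_atomic_cyl (A := A) (Z := ((((ι × ℕ) × ℕ) × ℕ) × ℕ) × ℕ)
        (L := fun y => L y.1.1.1.1.2) (G := fun y => G y.1.1.1.1.2) (x := fun y => y.1.1.1.2)
        (m := fun y => y.1.2) (v := fun y => y.2) (by fun_prop) (by fun_prop) (by fun_prop)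
        (by fun_prop) (by fun_prop)
      refine computablePred_forall_lt (α := ((ι × ℕ) × ℕ) × ℕ) (computablePred_forall_lt
        (α := (((ι × ℕ) × ℕ) × ℕ) × ℕ) (computablePred_and ?_ ?_) (by fun_prop)) (by fun_prop)
      · exact ((isRatComputable_atomic_shift_cyl (by fun_prop) (by fun_prop) (by fun_prop)
          (by fun_prop) (by fun_prop)).sub hc).abs.computablePred_le hk'
      · have hψ : ∀ u a, IsRatComputable fun y : ((((ι × ℕ) × ℕ) × ℕ) × ℕ) × ℕ =>
            β u a ((y.1.1.2, E y.1.1.1.1.2), 2 * y.1.1.1.1.2 + 4) := fun u a =>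
          (hβ u a).comp (g := fun y : ((((ι × ℕ) × ℕ) × ℕ) × ℕ) × ℕ =>
            ((y.1.1.2, E y.1.1.1.1.2), 2 * y.1.1.1.1.2 + 4)) (by fun_prop)
        exact ((isRatComputable_atomic_blk hψ (by fun_prop) (by fun_prop) (by fun_prop)
          (by fun_prop) (by fun_prop)).sub hc).abs.computablePred_le hk'
  -- A genuine pair passes the test after rounding ε to the grid and ν to a finitely supported
  -- measure.
  · rintro ⟨ε, haε, hεb, ν, hν, hd⟩ k
    obtain ⟨j, hj, hjε⟩ := exists_unitRatOfCode_near ε (E k)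
    have hE1 : 1 / ((E k : ℝ) + 1) ≤ (1 / 2 : ℝ) ^ (α (2 * k + 4) + k) := by
      have : (1 / 2 : ℝ) ^ (α (2 * k + 4) + k) = 1 / (E k : ℝ) := by simp [E]
      rw [this]
      exact one_div_le_one_div_of_le (by positivity) (by linarith)
    have hEα := hjε.trans (hE1.trans (pow_le_pow_of_le_one (by norm_num) (by norm_num)
      (Nat.le_add_right (α (2 * k + 4)) k)))
    have hEk := hjε.trans (hE1.trans (pow_le_pow_of_le_one (by norm_num) (by norm_num)
      (Nat.le_add_left k (α (2 * k + 4)))))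
    have hK0 : 0 < Fintype.card A ^ L k := pow_pos Fintype.card_pos _
    have hG0 : 0 < G k := Nat.mul_pos (by positivity) hK0
    obtain ⟨x, hx, hxd⟩ := exists_atomic ν.toMeasure (L k) hG0
    have hxd' : ellDist (L k) (atomic A (L k) (G k) x) ν.toMeasure ≤ (1 / 2 : ℝ) ^ (k + 2) := by
      refine hxd.trans (le_of_eq ?_)
      have hK : ((Fintype.card A ^ L k : ℕ) : ℝ) ≠ 0 := by exact_mod_cast hK0.ne'
      have h2 : (G k : ℝ) = 2 ^ (k + 3) * ((Fintype.card A ^ L k : ℕ) : ℝ) := by simp [G]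
      rw [h2, one_div_pow]
      field_simp
      ring
    have hkk : (1 / 2 : ℝ) ^ (k + 2) ≤ (1 / 2 : ℝ) ^ k :=
      pow_le_pow_of_le_one (by norm_num) (by norm_num) (by omega)
    rw [abs_le] at hEk
    refine ⟨x, hx, j, hj, by linarith, by linarith, ?_, ?_⟩
    · have h1 := partialDist_triangle k (atomic A (L k) (G k) x) ν.toMeasure (q i)
      have h2 := partialDist_le_ellDist (L := L k) (k := k) (by simp only [L]; omega)
        (atomic A (L k) (G k) x) ν.toMeasure
      have h3 := (measureDist_le_iff _ _ _).1 hd k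
      linarith
    · refine isAlmostInvariant_of_ellDist_le hν (fun u a => hβ0 u a _) (fun u a => hβ1 u a _)
        (fun u a => ?_) le_rfl hxd'
      have h1 := hval u a (j, E k) (2 * k + 4)
      have h2 := hmod (2 * k + 4) (unitRatOfCode (j, E k)) ε hEα u a
      -- Half of the tolerance is for evaluating the rule at the grid point, half for moving from
      -- the grid point to ε.
      have h3 : (1 / 2 : ℝ) ^ (2 * k + 3) = (1 / 2 : ℝ) ^ (2 * k + 4) + (1 / 2) ^ (2 * k + 4) := by
        ring
      rw [h3]
      exact (abs_sub_le _ _ _).trans (add_le_add h1 h2)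
  -- Candidates of different levels are unrelated. One ultrafilter gives limits of both the
  -- parameters and the measures, and all constraints are non-strict, so they survive.
  · choose x hx j hj h1 h2 h3 h4 using h
    let s : ℕ → unitInterval := fun k => unitRatOfCode (j k, E k)
    obtain ⟨ε, -, hε⟩ := isCompact_univ.ultrafilter_le_nhds ((hyperfilter ℕ).map s) (by simp)
    have hU : (hyperfilter ℕ : Filter ℕ) ≤ atTop := Nat.hyperfilter_le_atTop
    have hs : Tendsto s (hyperfilter ℕ) (𝓝 ε) := hε
    have hs' : Tendsto (fun k => (s k : ℝ)) (hyperfilter ℕ) (𝓝 ε) :=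
      (continuous_subtype_val.tendsto ε).comp hs
    have hp : Tendsto (fun k : ℕ => (1 / 2 : ℝ) ^ k) (hyperfilter ℕ) (𝓝 0) :=
      (tendsto_pow_atTop_nhds_zero_of_lt_one (by norm_num) (by norm_num)).mono_left hU
    refine ⟨ε, ?_, ?_, ?_⟩
    · have := ge_of_tendsto (hs'.add hp) (Eventually.of_forall h1)
      simpa using this
    · have := le_of_tendsto (hs'.sub hp) (b := b i)
        (Eventually.of_forall fun k => sub_le_iff_le_add.2 (h2 k))
      simpa using this
    · refine exists_invariant_of_isAlmostInvariant (hyperfilter ℕ) hU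
        (fun k => atomic A (L k) (G k) (x k)) (fun u a => ?_) h4 h3
      have h5 : Tendsto (fun k => β u a ((j k, E k), 2 * k + 4) - (P.rule (s k)).realProb u a)
          (hyperfilter ℕ) (𝓝 0) := by
        refine squeeze_zero_norm (fun k => (hval u a (j k, E k) (2 * k + 4)).trans ?_) hp
        exact pow_le_pow_of_le_one (by norm_num) (by norm_num) (by omega)
      simpa using h5.add (hP.tendsto_realProb hs u a)

end Perturbations
-- Zero-noise limits and stable measures: closedness and arithmetical description
section Limits

variable {A : Type*} [Fintype A] [MeasurableSpace A] [DiscreteMeasurableSpace A]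
  {F : CellularAutomaton A} {P : Perturbation F}

theorem isClosed_zeroNoiseLimits : IsClosed P.zeroNoiseLimits := by
  refine isClosed_of_closure_subset fun μ hμ δ hδ ε₀ hε₀ => ?_
  obtain ⟨μ', hμ', hd⟩ := Metric.mem_closure_iff.1 hμ (δ / 2) (by positivity)
  obtain ⟨ε, h0, h1, ν, hν, hd'⟩ := hμ' (δ / 2) (by positivity) ε₀ hε₀
  exact ⟨ε, h0, h1, ν, hν, (dist_triangle _ _ _).trans_lt (by linarith)⟩

variable [Nonempty A]

theorem Perturbation.invariantSet_nonempty (ε : ℝ) : (P.invariantSet ε).Nonempty :=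
  (P.rule ε).invariantMeasures_nonempty

/-- Conversely, choose π_ε in M_ε within ε of the infimum of the distances to ν; nonemptiness of M_ε
is needed for every ε > 0, large ones included. -/
theorem mem_stableMeasures_iff {ν : ShiftMeasure A} : ν ∈ P.stableMeasures ↔
    ∀ δ > (0 : ℝ), ∃ ε₀ > (0 : ℝ), ∀ ε : ℝ, 0 < ε → ε < ε₀ →
      ∃ π ∈ P.invariantSet ε, dist π ν < δ := by
  constructor
  · rintro ⟨π, hπ, hlim⟩ δ hδ
    have h := Metric.tendsto_nhds.1 hlim δ hδ
    rw [eventually_nhdsWithin_iff, Metric.eventually_nhds_iff] at h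
    obtain ⟨ε₀, hε₀, h⟩ := h
    refine ⟨ε₀, hε₀, fun ε h0 h1 => ⟨π ε, hπ ε h0, h ?_ h0⟩⟩
    rwa [Real.dist_eq, sub_zero, abs_of_pos h0]
  · intro h
    have hπ : ∀ ε : ℝ, 0 < ε → ∃ π ∈ P.invariantSet ε,
        dist ν π < Metric.infDist ν (P.invariantSet ε) + ε := fun ε hε =>
      (Metric.infDist_lt_iff (P.invariantSet_nonempty ε)).1 (lt_add_of_pos_right _ hε)
    have : Nonempty (ShiftMeasure A) := (P.invariantSet_nonempty 0).nonempty
    choose! π hπ hd using hπ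
    refine ⟨π, hπ, Metric.tendsto_nhds.2 fun δ hδ => ?_⟩
    obtain ⟨ε₀, hε₀, h⟩ := h (δ / 2) (by positivity)
    rw [eventually_nhdsWithin_iff, Metric.eventually_nhds_iff]
    refine ⟨min ε₀ (δ / 2), lt_min hε₀ (by positivity), fun ε hε h0 => ?_⟩
    rw [Real.dist_eq, sub_zero, abs_of_pos h0] at hε
    obtain ⟨ρ, hρ, hρd⟩ := h ε h0 (hε.trans_le (min_le_left _ _))
    have h1 := Metric.infDist_le_dist_of_mem (x := ν) hρ
    have h2 := hd ε h0
    rw [dist_comm ρ] at hρd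
    rw [dist_comm]
    have h3 := hε.trans_le (min_le_right _ _)
    linarith

theorem isClosed_stableMeasures : IsClosed P.stableMeasures := by
  refine isClosed_of_closure_subset fun μ hμ => mem_stableMeasures_iff.2 fun δ hδ => ?_
  obtain ⟨μ', hμ', hd⟩ := Metric.mem_closure_iff.1 hμ (δ / 2) (by positivity)
  obtain ⟨ε₀, hε₀, h⟩ := mem_stableMeasures_iff.1 hμ' (δ / 2) (by positivity)
  refine ⟨ε₀, hε₀, fun ε h0 h1 => ?_⟩
  obtain ⟨π, hπ, hd'⟩ := h ε h0 h1
  rw [dist_comm] at hd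
  exact ⟨π, hπ, (dist_triangle _ _ _).trans_lt (by linarith)⟩

/-- The space of shift-invariant measures is compact. -/
theorem exists_tendsto_shiftMeasure (U : Ultrafilter ℕ) (μ : ℕ → ShiftMeasure A) :
    ∃ ν : ShiftMeasure A, Tendsto μ U (𝓝 ν) := by
  obtain ⟨ν, hν, hlim⟩ := exists_limit_measure U fun k => (μ k).toMeasure
  have h1 : ∀ m v, ν.real (shift ⁻¹' cyl m v) = ν.real (cyl m v) := fun m v => by
    refine tendsto_nhds_unique ((isLocal_shift m v).tendsto_measureReal hlim) ?_
    simp only [ShiftMeasure.real_shift_cyl]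
    exact hlim m v
  refine ⟨ShiftMeasure.ofCyl ν h1, tendsto_iff_dist_tendsto_zero.2 ?_⟩
  simp only [dist_eq_measureDist]
  exact tendsto_measureDist hlim

theorem tendsto_one_div_hyperfilter :
    Tendsto (fun n : ℕ => 1 / ((n : ℝ) + 1)) (hyperfilter ℕ) (𝓝 0) :=
  tendsto_one_div_add_atTop_nhds_zero_nat.mono_left Nat.hyperfilter_le_atTop

/-- The measures found for successive n accumulate by compactness. Their limit is a zero-noise
limit, and the slack 1/(n+1) vanishes, leaving the exact radius. -/
theorem zeroNoiseLimits_inter_closedBall_nonempty_iff (q : ShiftMeasure A) (r : ℝ) :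
    (P.zeroNoiseLimits ∩ Metric.closedBall q r).Nonempty ↔ ∀ n : ℕ, ∃ m : ℕ, ∃ ε : unitInterval,
      1 / ((m : ℝ) + 1) ≤ ε ∧ (ε : ℝ) ≤ 1 / ((n : ℝ) + 1) ∧
        ∃ ν ∈ P.invariantSet ε, measureDist ν.toMeasure q.toMeasure ≤ r + 1 / ((n : ℝ) + 1) := by
  constructor
  · rintro ⟨μ, hμ, hμr⟩ n
    have hn : (0 : ℝ) < 1 / ((n : ℝ) + 1) := by positivity
    obtain ⟨ε, h0, h1, ν, hν, hd⟩ := hμ _ hn _ hn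
    obtain ⟨m, hm⟩ := exists_nat_one_div_lt h0
    have hn1 : 1 / ((n : ℝ) + 1) ≤ 1 := by
      rw [div_le_one (by positivity)]
      linarith [(Nat.cast_nonneg n : (0 : ℝ) ≤ n)]
    refine ⟨m, ⟨ε, h0.le, h1.le.trans hn1⟩, hm.le, h1.le, ν, hν, ?_⟩
    rw [← dist_eq_measureDist]
    have h2 := dist_triangle ν μ q
    rw [dist_comm] at hd
    have h3 := Metric.mem_closedBall.1 hμr
    linarith
  · intro h
    choose m ε h1 h2 ν hν hd using h
    obtain ⟨μ, hμ⟩ := exists_tendsto_shiftMeasure (hyperfilter ℕ) ν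
    refine ⟨μ, fun δ hδ ε₀ hε₀ => ?_, ?_⟩
    · obtain ⟨n, hn, hn'⟩ := ((Metric.tendsto_nhds.1 hμ δ hδ).and
        (tendsto_one_div_hyperfilter.eventually (gt_mem_nhds hε₀))).exists
      refine ⟨ε n, lt_of_lt_of_le (by positivity) (h1 n), (h2 n).trans_lt hn', ν n, hν n, ?_⟩
      rwa [dist_comm]
    · have h3 := le_of_tendsto_of_tendsto (hμ.dist (tendsto_const_nhds (x := q)))
        (tendsto_one_div_hyperfilter.const_add r) (Eventually.of_forall fun n => by
          change dist (ν n) q ≤ _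
          rw [dist_eq_measureDist]
          exact hd n)
      simpa using h3

/-- The set of parameters with an invariant measure near `q` is closed. -/
theorem exists_invariant_near_of_rat (hP : P.IsComputable) {q : Measure (ℤ → A)}
    [IsProbabilityMeasure q] {r b : ℝ} (hb : b ≤ 1)
    (h : ∀ c : ℕ × ℕ, 0 < (unitRatOfCode c : ℝ) → (unitRatOfCode c : ℝ) ≤ b →
      ∃ ν ∈ P.invariantSet (unitRatOfCode c), measureDist ν.toMeasure q ≤ r)
    {ε : ℝ} (h0 : 0 < ε) (h1 : ε < b) :
    ∃ ν ∈ P.invariantSet ε, measureDist ν.toMeasure q ≤ r := by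
  -- Grids with denominators at least K + 1 are fine enough for the approximations of ε to stay in
  -- (0, b].
  obtain ⟨K, hK⟩ := exists_nat_one_div_lt (lt_min h0 (sub_pos.2 h1))
  let e : unitInterval := ⟨ε, h0.le, (h1.trans_le hb).le⟩
  choose j _ hj using fun k : ℕ => exists_unitRatOfCode_near e (K + k)
  have hjK : ∀ k : ℕ, |(unitRatOfCode (j k, K + k) : ℝ) - ε| < min ε (b - ε) := fun k => by
    refine lt_of_le_of_lt ((hj k).trans (one_div_le_one_div_of_le (by positivity) ?_)) hK
    push_cast
    linarith [(Nat.cast_nonneg k : (0 : ℝ) ≤ k)]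
  have hpos : ∀ k : ℕ, 0 < (unitRatOfCode (j k, K + k) : ℝ) := fun k => by
    have := (abs_lt.1 ((hjK k).trans_le (min_le_left _ _))).1
    linarith
  have hle : ∀ k : ℕ, (unitRatOfCode (j k, K + k) : ℝ) ≤ b := fun k => by
    have := (abs_lt.1 ((hjK k).trans_le (min_le_right _ _))).2
    linarith
  choose ν hν hd using fun k => h _ (hpos k) (hle k)
  have hlim : Tendsto (fun k => unitRatOfCode (j k, K + k)) (hyperfilter ℕ) (𝓝 e) := by
    refine tendsto_iff_dist_tendsto_zero.2 (squeeze_zero (fun _ => dist_nonneg)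
      (fun k => (hj k).trans (one_div_le_one_div_of_le (by positivity) ?_))
      tendsto_one_div_hyperfilter)
    push_cast
    linarith [(Nat.cast_nonneg K : (0 : ℝ) ≤ K)]
  obtain ⟨ν', hν', hc⟩ := exists_invariant_of_tendsto_rule (hyperfilter ℕ) ν
    (fun k => P.rule (unitRatOfCode (j k, K + k))) (P.rule ε) (hP.tendsto_realProb hlim) hν
  exact ⟨ν', hν', measureDist_le_of_tendsto Nat.hyperfilter_le_atTop hc
    (tendsto_const_nhds (x := r)) fun k => (measureDist_le_iff _ _ _).1 (hd k) k⟩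

/-- The finitely supported measures for different n need no coherence: each one is close to M_ε for
all small ε, so any accumulation point of them is stable. -/
theorem stableMeasures_inter_closedBall_nonempty_iff (hP : P.IsComputable) (q : ShiftMeasure A)
    (r : ℝ) : (P.stableMeasures ∩ Metric.closedBall q r).Nonempty ↔
      ∀ n : ℕ, ∃ L G x m : ℕ,
        measureDist (atomic A L G x) q.toMeasure ≤ r + 1 / ((n : ℝ) + 1) ∧
        ∀ c : ℕ × ℕ, 0 < (unitRatOfCode c : ℝ) → (unitRatOfCode c : ℝ) ≤ 1 / ((m : ℝ) + 1) →
          ∃ ν ∈ P.invariantSet (unitRatOfCode c),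
            measureDist ν.toMeasure (atomic A L G x) ≤ 1 / ((n : ℝ) + 1) := by
  constructor
  · rintro ⟨ν, hν, hνr⟩ n
    have hn : (0 : ℝ) < 1 / ((n : ℝ) + 1) := by positivity
    obtain ⟨L, G, x, hx⟩ := exists_atomic_measureDist_lt ν.toMeasure (half_pos hn)
    obtain ⟨ε₀, hε₀, h⟩ := mem_stableMeasures_iff.1 hν _ (half_pos hn)
    obtain ⟨m, hm⟩ := exists_nat_one_div_lt hε₀
    refine ⟨L, G, x, m, ?_, fun c hc0 hc1 => ?_⟩
    · have h1 := measureDist_triangle (atomic A L G x) ν.toMeasure q.toMeasure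
      have h2 := Metric.mem_closedBall.1 hνr
      rw [dist_eq_measureDist] at h2
      linarith
    · obtain ⟨π, hπ, hd⟩ := h _ hc0 (hc1.trans_lt hm)
      refine ⟨π, hπ, ?_⟩
      have h1 := measureDist_triangle π.toMeasure ν.toMeasure (atomic A L G x)
      rw [dist_eq_measureDist] at hd
      rw [measureDist_comm] at hx
      linarith
  · intro h
    choose L G x m h1 h2 using h
    have hν : ∀ n, ∃ ν : ShiftMeasure A,
        measureDist ν.toMeasure (atomic A (L n) (G n) (x n)) ≤ 1 / ((n : ℝ) + 1) := fun n => by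
      -- This admissible parameter provides a shift-invariant measure near the finitely supported
      -- one, which itself is not a point of the space.
      have hc : (unitRatOfCode (1, m n) : ℝ) = 1 / ((m n : ℝ) + 1) := by simp [unitRatOfCode]
      obtain ⟨ν, -, hν⟩ := h2 n (1, m n) (by rw [hc]; positivity) hc.le
      exact ⟨ν, hν⟩
    choose ν hν using hν
    obtain ⟨μ, hμ⟩ := exists_tendsto_shiftMeasure (hyperfilter ℕ) ν
    refine ⟨μ, mem_stableMeasures_iff.2 fun δ hδ => ?_, ?_⟩
    -- A single n suffices: two steps of size less than δ/4 lead from π through the finitely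
    -- supported measure to ν n, and less than δ/2 remains to μ.
    · obtain ⟨n, hn, hn'⟩ := ((Metric.tendsto_nhds.1 hμ (δ / 2) (half_pos hδ)).and
        (tendsto_one_div_hyperfilter.eventually (gt_mem_nhds
          (show 0 < δ / 4 by positivity)))).exists
      have hm1 : 1 / ((m n : ℝ) + 1) ≤ 1 := by
        rw [div_le_one (by positivity)]
        linarith [(Nat.cast_nonneg (m n) : (0 : ℝ) ≤ m n)]
      refine ⟨1 / ((m n : ℝ) + 1), by positivity, fun ε h0 hε => ?_⟩
      obtain ⟨π, hπ, hd⟩ := exists_invariant_near_of_rat hP hm1 (h2 n) h0 hε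
      refine ⟨π, hπ, ?_⟩
      have h3 := dist_triangle π (ν n) μ
      have h4 := measureDist_triangle π.toMeasure (atomic A (L n) (G n) (x n)) (ν n).toMeasure
      rw [measureDist_comm (atomic A (L n) (G n) (x n)), ← dist_eq_measureDist] at h4
      linarith [hν n]
    · have h3 := le_of_tendsto_of_tendsto (hμ.dist (tendsto_const_nhds (x := q)))
        ((tendsto_one_div_hyperfilter.const_mul 2).const_add r) (Eventually.of_forall fun n => by
          have h4 := measureDist_triangle (ν n).toMeasure (atomic A (L n) (G n) (x n)) q.toMeasure
          change dist (ν n) q ≤ r + 2 * (1 / ((n : ℝ) + 1))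
          rw [dist_eq_measureDist]
          linarith [hν n, h1 n])
      simpa using h3

variable [Primcodable A]

theorem isRatComputable_one_div_add_one {Z : Type*} [Primcodable Z] {n : Z → ℕ}
    (hn : Computable n) : IsRatComputable fun z => 1 / ((n z : ℝ) + 1) :=
  (IsRatComputable.inv_natCast (g := fun z => n z + 1) (by fun_prop)).of_eq fun z => by
    push_cast
    rw [one_div]

theorem isPiThreeComputableClosed_zeroNoiseLimits (hP : P.IsComputable) :
    IsPiThreeComputableClosed (periodicMeasure : A × List A → ShiftMeasure A)
      P.zeroNoiseLimits := by
  refine ⟨isClosed_zeroNoiseLimits, ?_⟩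
  obtain ⟨T, hT, h⟩ := exists_test hP (ι := ((A × List A) × (ℤ × ℕ)) × ℕ × ℕ)
    (q := fun i => (periodicMeasure i.1.1).toMeasure)
    (isComputableFamily_periodicMeasure.comp (by fun_prop))
    (r := fun i => ((ratOfCode i.1.2 : ℚ) : ℝ) + 1 / ((i.2.1 : ℝ) + 1))
    ((isRatComputable_ratOfCode.comp (g := fun i : ((A × List A) × (ℤ × ℕ)) × ℕ × ℕ => i.1.2)
      (by fun_prop)).add (isRatComputable_one_div_add_one (by fun_prop)))
    (a := fun i => 1 / ((i.2.2 : ℝ) + 1)) (b := fun i => 1 / ((i.2.1 : ℝ) + 1))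
    (isRatComputable_one_div_add_one (by fun_prop)) (isRatComputable_one_div_add_one (by fun_prop))
  obtain ⟨f, hf, hfT⟩ := ComputablePred.computable_iff.1 hT
  refine ⟨fun y => f (((y.1, y.2.1), (y.2.2.1, y.2.2.2.1)), y.2.2.2.2), by fun_prop,
    fun i c => ?_⟩
  rw [zeroNoiseLimits_inter_closedBall_nonempty_iff]
  refine forall_congr' fun n => exists_congr fun m => (h ((i, c), (n, m))).trans ?_
  exact forall_congr' fun k => iff_of_eq (congrFun hfT (((i, c), (n, m)), k))

theorem isPiThreeComputableClosed_stableMeasures (hP : P.IsComputable) :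
    IsPiThreeComputableClosed (periodicMeasure : A × List A → ShiftMeasure A)
      P.stableMeasures := by
  refine ⟨isClosed_stableMeasures, ?_⟩
  -- Taking a = b pins the parameter to a given rational.
  obtain ⟨T, hT, h⟩ := exists_test hP (ι := ((ℕ × ℕ × ℕ) × ℕ) × (ℕ × ℕ))
    (q := fun i => atomic A i.1.1.1 i.1.1.2.1 i.1.1.2.2)
    (isComputableFamily_atomic (by fun_prop) (by fun_prop) (by fun_prop))
    (r := fun i => 1 / ((i.1.2 : ℝ) + 1)) (isRatComputable_one_div_add_one (by fun_prop))
    (a := fun i => (unitRatOfCode i.2 : ℝ)) (b := fun i => (unitRatOfCode i.2 : ℝ))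
    (isRatComputable_unitRatOfCode.comp (by fun_prop))
    (isRatComputable_unitRatOfCode.comp (by fun_prop))
  have h' : ∀ i, (∃ ν ∈ P.invariantSet (unitRatOfCode i.2),
      measureDist ν.toMeasure (atomic A i.1.1.1 i.1.1.2.1 i.1.1.2.2) ≤ 1 / ((i.1.2 : ℝ) + 1)) ↔
      ∀ k, T i k := fun i => by
    refine Iff.trans ⟨fun hν => ⟨unitRatOfCode i.2, le_rfl, le_rfl, hν⟩, ?_⟩ (h i)
    rintro ⟨ε, h1, h2, hν⟩
    rwa [le_antisymm h1 h2]
  -- Two universal conditions are merged under one quantifier: the last number is both the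
  -- truncation level of the distance and the level of the test.
  let S : ((A × List A) × (ℤ × ℕ) × ℕ) × ((ℕ × ℕ × ℕ) × ℕ) × ((ℕ × ℕ) × ℕ) → Prop := fun y =>
    partialDist y.2.2.2 (atomic A y.2.1.1.1 y.2.1.1.2.1 y.2.1.1.2.2)
        (periodicMeasure y.1.1).toMeasure
      ≤ ((ratOfCode y.1.2.1 : ℚ) : ℝ) + 1 / ((y.1.2.2 : ℝ) + 1) ∧
    (((0 : ℕ) : ℝ) < unitRatOfCode y.2.2.1 → (unitRatOfCode y.2.2.1 : ℝ) ≤ 1 / ((y.2.1.2 : ℝ) + 1) →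
      T ((y.2.1.1, y.1.2.2), y.2.2.1) y.2.2.2)
  have hS : ComputablePred S := by
    have hu : IsRatComputable
        fun y : ((A × List A) × (ℤ × ℕ) × ℕ) × ((ℕ × ℕ × ℕ) × ℕ) × ((ℕ × ℕ) × ℕ) =>
          (unitRatOfCode y.2.2.1 : ℝ) := isRatComputable_unitRatOfCode.comp (by fun_prop)
    refine computablePred_and ?_ (computablePred_imp ?_ (computablePred_imp ?_ ?_))
    · refine (IsComputableFamily.partialDist (isComputableFamily_atomic (by fun_prop) (by fun_prop)
        (by fun_prop)) (isComputableFamily_periodicMeasure.comp (by fun_prop))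
        (by fun_prop)).computablePred_le
        ((isRatComputable_ratOfCode.comp (by fun_prop)).add
          (isRatComputable_one_div_add_one (by fun_prop)))
    · exact (IsRatComputable.natCast (Computable.const 0)).computablePred_lt hu
    · exact hu.computablePred_le (isRatComputable_one_div_add_one (by fun_prop))
    · exact computablePred_comp hT
        (g := fun y : ((A × List A) × (ℤ × ℕ) × ℕ) × ((ℕ × ℕ × ℕ) × ℕ) × ((ℕ × ℕ) × ℕ) =>
          (((y.2.1.1, y.1.2.2), y.2.2.1), y.2.2.2)) (by fun_prop)
  obtain ⟨f, hf, hfS⟩ := ComputablePred.computable_iff.1 hS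
  obtain ⟨d, hd, hsurj⟩ : ∃ d : ℕ → (ℕ × ℕ × ℕ) × ℕ, Computable d ∧ Function.Surjective d :=
    ⟨_, Computable.ofNat _, fun z => ⟨Encodable.encode z, Denumerable.ofNat_encode z⟩⟩
  obtain ⟨d', hd', hsurj'⟩ : ∃ d : ℕ → (ℕ × ℕ) × ℕ, Computable d ∧ Function.Surjective d :=
    ⟨_, Computable.ofNat _, fun z => ⟨Encodable.encode z, Denumerable.ofNat_encode z⟩⟩
  refine ⟨fun y => f ((y.1, y.2.1, y.2.2.1), d y.2.2.2.1, d' y.2.2.2.2), by fun_prop,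
    fun i c => ?_⟩
  rw [stableMeasures_inter_closedBall_nonempty_iff hP]
  refine forall_congr' fun n => ?_
  have hfS' : ∀ y, f y = true ↔ S y := fun y => (iff_of_eq (congrFun hfS y)).symm
  simp only [hfS']
  rw [← hsurj.exists (p := fun z => ∀ y₃ : ℕ,
    S ((i, c, n), z, d' y₃))]
  have h3 : ∀ z, (∀ y₃ : ℕ, S ((i, c, n), z, d' y₃)) ↔
      ∀ y, S ((i, c, n), z, y) := fun z =>
    (hsurj'.forall (p := fun y => S ((i, c, n), z, y))).symm
  simp only [h3]
  constructor
  · rintro ⟨L, G, x, m, h1, h2⟩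
    refine ⟨((L, G, x), m), fun y => ⟨(measureDist_le_iff _ _ _).1 h1 _, fun h0 hm => ?_⟩⟩
    exact (h' (((L, G, x), n), y.1)).1 (h2 y.1 (by simpa using h0) hm) y.2
  · rintro ⟨⟨⟨L, G, x⟩, m⟩, hy⟩
    -- The distance bound does not involve the parameter, so the code (0, 0) is an arbitrary filler.
    refine ⟨L, G, x, m, (measureDist_le_iff _ _ _).2 fun k => (hy ((0, 0), k)).1,
      fun c' h0 hm => (h' (((L, G, x), n), c')).2 fun k => (hy (c', k)).2 (by simpa using h0) hm⟩

end Limits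

theorem ShiftMeasure.isEmpty {A : Type*} [IsEmpty A] [MeasurableSpace A] :
    IsEmpty (ShiftMeasure A) := by
  refine ⟨fun μ => ?_⟩
  have h := measure_univ (μ := μ.toMeasure)
  rw [Set.univ_eq_empty_iff.2 inferInstance, measure_empty] at h
  exact zero_ne_one h

/-- This covers the empty alphabet, for which there are no nonempty words and hence no balls to
decide. -/
theorem isPiThreeComputableClosed_of_isEmpty {ι X : Type*} [Primcodable ι] [PseudoMetricSpace X]
    [IsEmpty ι] [IsEmpty X] (p : ι → X) (K : Set X) : IsPiThreeComputableClosed p K :=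
  ⟨by rw [Set.eq_empty_of_isEmpty K]; exact isClosed_empty, fun _ => true, Computable.const _,
    fun i => isEmptyElim i⟩

end NoisyCA

theorem mainTheorem5 {A : Type*} [Fintype A] [Primcodable A] [MeasurableSpace A]
    [DiscreteMeasurableSpace A] (F : NoisyCA.CellularAutomaton A) (P : NoisyCA.Perturbation F)
    (hP : P.IsComputable) :
    NoisyCA.IsPiThreeComputableClosed
        (NoisyCA.periodicMeasure : A × List A → NoisyCA.ShiftMeasure A) P.zeroNoiseLimits ∧
      NoisyCA.IsPiThreeComputableClosed
        (NoisyCA.periodicMeasure : A × List A → NoisyCA.ShiftMeasure A) P.stableMeasures := by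
  rcases isEmpty_or_nonempty A with h | h
  · have := NoisyCA.ShiftMeasure.isEmpty (A := A)
    exact ⟨NoisyCA.isPiThreeComputableClosed_of_isEmpty _ _,
      NoisyCA.isPiThreeComputableClosed_of_isEmpty _ _⟩
  · exact ⟨NoisyCA.isPiThreeComputableClosed_zeroNoiseLimits hP,
      NoisyCA.isPiThreeComputableClosed_stableMeasures hP⟩
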